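/- **Setting.** Let $\mathbb S$ be a set of sorts with a well-founded strict order $<_{\mathbb S}$; (simple) types are built from sorts with $\to$. Let $\mathbb C$ and $\mathbb F$ be sets of constructors and function symbols, each symbol $s$ with a declared type $\Theta(s)=T_1\to\dots\to T_{r^s}\to B$, $B$ a sort. Terms are Church-style simply-typed $\lambda$-terms (modulo $\alpha$-equivalence) over an infinite countable set of variables and these symbols. Let $\mathcal R$ be a set of rewrite rules $l\to r$: $l=f\,\vec l$ with $f\in\mathbb F$, $l$ typable, $FV(r)\subseteq FV(l)$, and $\Gamma\vdash l:U$ implies $\Gamma\vdash r:U$. Let $\to_{\mathcal R}$ be the smallest relation containing $\mathcal R$ that is stable by substitution and by context, let ${\to}={\to_\beta}\cup{\to_{\mathcal R}}$, and let $SN$ be the set of its strongly normalizing terms. A term is neutral if it has the form $x\vec v$, $(\lambda x^U t)u\vec v$, or $f\vec t$ with $|\vec t|\ge|\vec l|$ for every rule $f\vec l\to r$. A computability predicate is a set $P\subseteq SN$ of terms closed under $\to$ and containing every neutral term all of whose reducts are in $P$; $\mathrm{lub}$ is the least upper bound for inclusion among these predicates. An interpretation of sorts by sets of terms is extended to types by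 $U\to V\mapsto\{t\mid\forall u\in U,\ tu\in V\}$; $[B:X]T$ is the interpretation of $T$ when $B$ is interpreted by $X$ and the other sorts are unchanged. Write $t\Rightarrow_B c\,\vec t$ if $t\to^*c\,\vec t$, $c:T_1\to\dots\to T_{r^c}\to B$ and $|\vec t|=r^c$. For each constructor $c:\vec T\to B$ there are $0\le p^c\le q^c\le r^c$ such that, for $i\le q^c$, every sort occurring in $T_i$ is $\le_{\mathbb S}B$ and $B$ occurs only positively in $T_i$, and, for such $i$, $B$ occurs in $T_i$ if $i\le p^c$ and does not if $i>p^c$. The interpretation of a sort $B$ (also written $B$) is defined by induction on $<_{\mathbb S}$ as the least fixpoint of $$X\mapsto\{t\in SN\mid\text{whenever }t\Rightarrow_B c\,\vec t,\ t_k\in[B:X]T_k\text{ for all }k\le q^c\}.$$ Let $\mathfrak h$ be the smallest ordinal that does not inject into the set of all sets of terms. A size algebra consists of the first-order terms $A$ over size variables and size function symbols, a quasi-order $\le_A$ and a strict order ${<_A}\subseteq{\le_A}$, both stable by substitution, and an interpretation $g_{\mathfrak h}:\mathfrak h^n\to\mathfrak h$ of each symbol $g$ of arity $n$ such that $a\le_A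 b$ (resp. $a<_A b$) implies $a\mu\le b\mu$ (resp. $a\mu<b\mu$) for all valuations $\mu$ in $\mathfrak h$. An argument of $g$ is called monotone (anti-monotone) if $g$ is monotone (anti-monotone) in it for $\le_A$ and so is $g_{\mathfrak h}$ for the order on ordinals. A variable occurrence in a size expression is positive if each argument on the path to it can be labelled as monotone or as anti-monotone, correctly for the symbol concerned, with an even number of labels anti-monotone. Let $\bar A=A\cup\{\infty\}$, with $a\le b$ in $\bar A$ if $a\le_A b$ or $b=\infty$; substituting $\infty$ for a variable of $a$ gives $\infty$. Annotated types are types in which each sort $B$ carries some $a\in\bar A$, written $B_a$, with $B_\infty=B$; $|U|$ erases the annotations of $U$, and $\mathrm{An}(T,B,a)$ annotates all occurrences of $B$ in $T$ by $a$. Subtyping is the reflexive-transitive relation generated by $B_a\le B_b$ for $a\le b$, contravariantly on the left and covariantly on the right of $\to$. **Annotated constructors.** Each $c$ with $\Theta(c)=\vec T\to B$ has an annotated type $\bar T_1\to\dots\to\bar T_{r^c}\to B_{\sigma^c}$ with $\sigma^c\in\bar A$, $\bar T_i=\mathrm{An}(T_i,B^c_i,\alpha^c_i)$ for $i\le q^c$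 and $\bar T_i=T_i$ for $i>q^c$. For $i\le p^c$, $\alpha^c_i$ is a size variable and $B^c_i=B$. For $p^c<i\le q^c$, $\alpha^c_i$ is a size variable or $\infty$, and if it is a variable then the sort $B^c_i$ occurs in $T_i$, and only positively. The variables among the $\alpha^c_i$ are pairwise equal or pairwise distinct. All size variables of $\sigma^c$ occur only positively in $\sigma^c$, and, if $\sigma^c\ne\infty$, $\alpha^c_i<_A\sigma^c$ for $i\le p^c$. The size function is $\Sigma^c(\vec\kappa)=0$ if $\sigma^c=\infty$, and $\Sigma^c(\vec\kappa)=\sigma^c\nu$ with $\nu(\alpha)=\sup\{\kappa_i\mid i\le q^c,\ \alpha^c_i=\alpha\}$ otherwise. The stratification $(\mathcal S^B_\kappa)_{\kappa<\mathfrak h}$ of $B$ is defined by induction on $<_{\mathbb S}$ and $\kappa$. For $\kappa$ an infinite limit, $\mathcal S^B_\kappa=\mathrm{lub}\{\mathcal S^B_\beta\mid\beta<\kappa\}$. For $\kappa=0$ or $\kappa=\beta+1$, $\mathcal S^B_\kappa$ is the set of $t\in SN$ such that, whenever $t\Rightarrow_B c\,\vec t$: if $\kappa=0$ then $p^c=0$;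 if $\kappa=\beta+1$ then $t_k\in[B:\mathcal S^B_\beta]T_k$ for $k\le p^c$; $t_k\in T_k$ for $p^c<k\le q^c$; and $\Sigma^c(o_1,\dots,o_{q^c})\le\kappa$, where $o_k$ is the size of $t_k$ in $T_k$ with respect to $B^c_k$. Here the size of $t$ in $T$ with respect to a sort $D$ is the least $\kappa$ such that $t\in[D:\mathcal S^D_\kappa]T$ (the values $o_k$ with $\alpha^c_k=\infty$ are irrelevant to $\Sigma^c$). **Annotated functions and calls.** Let $\le_{\mathbb F}$ be a quasi-order on $\mathbb F$ with well-founded strict part $<_{\mathbb F}$ and equivalence $\simeq$. Each $f$ with $\Theta(f)=\vec T\to B$ has a number $q^f\le r^f$ such that $T_1,\dots,T_{q^f}$ are sorts, and an annotated type $\bar T_1\to\dots\to\bar T_{r^f}\to B_{\sigma^f}$ with $\bar T_i=\mathrm{An}(T_i,T_i,\alpha^f_i)$ for $i\le q^f$ and $\bar T_i=T_i$ for $i>q^f$, where $\alpha^f_1,\dots,\alpha^f_{q^f}$ are distinct variables, $\sigma^f\in\bar A$ and $\mathrm{Var}(\sigma^f)\subseteq\{\vec\alpha^f\}$. For $X\in\{A,\mathfrak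 h\}$ there are a set $D^f_X$ with a quasi-order $\le^f_X$ and a well-founded relation ${<^f_X}\subseteq{\le^f_X}$, the same for equivalent symbols, and a map $\zeta^f_X:X^{q^f}\to D^f_X$. Write $\vec x<^{g,f}_X\vec y$ if $g\simeq f$ and $\zeta^g_X(\vec x)<^f_X\zeta^f_X(\vec y)$. It is assumed that $\vec a<^{g,f}_A\vec b$ implies $\vec a\mu<^{g,f}_{\mathfrak h}\vec b\mu$ for all $\mu$, and that $<^{g,f}_A$ (resp. $<^{g,f}_{\mathfrak h}$) is preserved when one coordinate of its left argument is replaced by a $\le_A$-smaller one (resp. one coordinate of its right argument by a $\le$-larger one). For $f\in\mathbb F$ and $\varphi:\{\vec\alpha^f\}\to A$, the relation $\Gamma\vdash^f_\varphi t:T$ (with $\Gamma$ a finite map from variables to annotated types) is the smallest one such that: * (app-decr) if a symbol or variable $h$ has annotated type $\vec V\to V$, $|\vec w|=|\vec V|$ and $\Gamma\vdash^f_\varphi w_i:V_i\psi$ for all $i$, then $\Gamma\vdash^f_\varphi h\,\vec w:V\psi$. Here $\psi$ is the identity if $h$ is a variable (with type given by $\Gamma$), and an arbitrary substitution of size variables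 by elements of $\bar A$ if $h$ is a symbol; if $h\in\mathbb F$, it is moreover required that $h<_{\mathbb F}f$, or that $h\simeq f$, $|\vec V|\ge q^h$, $\vec\alpha^h\psi$ is finite and $\vec\alpha^h\psi<^{h,f}_A\vec\alpha^f\varphi$; * (lam) if $\Gamma,x:U\vdash^f_\varphi w:V$ with $U$ a simple type, then $\Gamma\vdash^f_\varphi\lambda x^Uw:U\to V$; * (sub) if $\Gamma\vdash^f_\varphi t:U$ and $U\le V$, then $\Gamma\vdash^f_\varphi t:V$. The accessibility relation $\trianglelefteq$ on triples (term, type, sort) is the smallest reflexive relation such that $(u,U,D)\trianglelefteq(c\,\vec t,B,B)$ whenever $c:\vec T\to B$, $|\vec t|=r^c$, $k\le q^c$ and $(u,U,D)\trianglelefteq(t_k,T_k,B^c_k)$. **Theorem (termination criterion).** Assume that $\to_{\mathcal R}$ is finitely branching and that $\Sigma^c(\vec\kappa)$ is never an infinite limit ordinal, for any constructor $c$ and any $\vec\kappa$ in $\mathfrak h$. Assume that for every rule $l\to r$ in $\mathcal R$, with $l=f\,\vec l$ and $\Theta(f)=\vec T\to B$, one has $|\vec l|\ge q^f$ and there are an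 environment $\Gamma$ of annotated types with domain $FV(r)$, for each $(x,U)\in\Gamma$ an index $k^x\le|\vec l|$ such that $x$ occurs in $l_{k^x}$, a sort $B^x$ occurring only positively (possibly not at all) in $|U|$ and a size variable $\alpha^x$ with $U=\mathrm{An}(|U|,B^x,\alpha^x)$, and finite size bounds $\varphi:\{\vec\alpha^f\}\to A$, such that: * *Monotony.* Each $\alpha^f_i$ ($i\le q^f$) occurs only positively in $\sigma^f$. * *Accessibility.* For each $(x,U)\in\Gamma$, either $x=l_{k^x}$ and $U=\bar T_{k^x}\varphi$, or $T_{k^x}$ is a sort and $(x,|U|,B^x)\trianglelefteq(l_{k^x},T_{k^x},T_{k^x})$. * *Minimality.* For every substitution $\theta$ with $l_i\theta\in T_i$ for all $i\le|\vec l|$, there is a valuation $\nu$ in $\mathfrak h$ such that for each $(x,U)\in\Gamma$ the size of $x\theta$ in $|U|$ with respect to $B^x$ is at most $\nu(\alpha^x)$, and for each $i\le q^f$, $\alpha^f_i\varphi\nu$ equals the size of $l_i\theta$ in the sort $T_i$. * *Subject-reduction and decreasingness.* $\Gamma\vdash^f_\varphi r:T_{|\vec l|+1}\to\dots\to T_{r^f}\to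 B_{\sigma^f}\varphi$. Then every well-typed term is strongly normalizing for ${\to}={\to_\beta}\cup{\to_{\mathcal R}}$. -/

import Mathlib

namespace SizeTermination

open Classical

/-! ## Simple types -/

/-- Simple types over a set `S` of sorts. -/
inductive Ty (S : Type) : Type
  | base : S → Ty S
  | arrow : Ty S → Ty S → Ty S

namespace Ty
variable {S : Type}

/-- Maximal number of arguments of a term of the given type. -/
def arity : Ty S → ℕ
  | base _ => 0
  | arrow _ V => V.arity + 1

/-- The sort `B` of `T₁ → ⋯ → Tᵣ → B`. -/
def resSort : Ty S → S
  | base B => B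
  | arrow _ V => V.resSort

/-- The argument type of index `k` (counted from `0`) of `T₁ → ⋯ → Tᵣ → B`;
only used for `k < r`. -/
def argTy : Ty S → ℕ → Ty S
  | base B, _ => base B
  | arrow U _, 0 => U
  | arrow _ V, k + 1 => V.argTy k

/-- The set `Pos(B, T)` of the positions of the sort `B` in a type. -/
def occ (B : S) : Ty S → Set (List ℕ)
  | base D => {p | p = [] ∧ D = B}
  | arrow U V => {p | ∃ p', (p = 1 :: p' ∧ p' ∈ occ B U) ∨ (p = 2 :: p' ∧ p' ∈ occ B V)}

/-- The positive (`s = true`) and negative (`s = false`) positions of a type. -/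
def pos : Bool → Ty S → Set (List ℕ)
  | s, base _ => {p | p = [] ∧ s = true}
  | s, arrow U V =>
    {p | ∃ p', (p = 1 :: p' ∧ p' ∈ pos (!s) U) ∨ (p = 2 :: p' ∧ p' ∈ pos s V)}

/-- The sort `B` occurs only positively in `T` (possibly not at all). -/
def OnlyPos (B : S) (T : Ty S) : Prop := T.occ B ⊆ T.pos true

/-- `T` is positive with respect to `B`. -/
def PositiveWrt [PartialOrder S] (B : S) (T : Ty S) : Prop :=
  (∀ D, T.occ D = ∅ ∨ D ≤ B) ∧ T.OnlyPos B

end Ty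

/-! ## Terms, in de Bruijn notation

The set of term variables is `ℕ`, and terms modulo renaming of bound variables are represented
by de Bruijn terms: below an abstraction, `var 0` is the bound variable and `var (n + 1)` is the
variable `n` of the surrounding scope. -/

/-- Church-style terms over the constructors `C` and the function symbols `F`. -/
inductive Term (S C F : Type) : Type
  | var : ℕ → Term S C F
  | con : C → Term S C F
  | fn : F → Term S C F
  | lam : Ty S → Term S C F → Term S C F
  | app : Term S C F → Term S C F → Term S C F

namespace Term
variable {S C F : Type}

/-- The application `t u₁ … uₙ`. -/
def apps (t : Term S C F) (us : List (Term S C F)) : Term S C F := us.foldl app t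

/-- The entry of index `k` (counted from `0`) of a list of terms; only used for `k < ts.length`. -/
def nth (ts : List (Term S C F)) (k : ℕ) : Term S C F := ts.getD k (var 0)

/-- Extension of a renaming below a binder. -/
def upRen (ρ : ℕ → ℕ) : ℕ → ℕ
  | 0 => 0
  | n + 1 => ρ n + 1

/-- Renaming of variables. -/
def rename : (ℕ → ℕ) → Term S C F → Term S C F
  | ρ, var n => var (ρ n)
  | _, con c => con c
  | _, fn f => fn f
  | ρ, lam U t => lam U (rename (upRen ρ) t)
  | ρ, app t u => app (rename ρ t) (rename ρ u)

/-- Extension of a substitution below a binder. -/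
def up (θ : ℕ → Term S C F) : ℕ → Term S C F
  | 0 => var 0
  | n + 1 => rename Nat.succ (θ n)

/-- Capture-avoiding substitution. -/
def subst : (ℕ → Term S C F) → Term S C F → Term S C F
  | θ, var n => θ n
  | _, con c => con c
  | _, fn f => fn f
  | θ, lam U t => lam U (subst (up θ) t)
  | θ, app t u => app (subst θ t) (subst θ u)

/-- The substitution of `u` for the variable bound by an abstraction. -/
def inst (u : Term S C F) : ℕ → Term S C F
  | 0 => u
  | n + 1 => var n

/-- Free variables. -/
def FV : Term S C F → Set ℕ
  | var n => {n}
  | con _ => ∅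
  | fn _ => ∅
  | lam _ t => {n | n + 1 ∈ FV t}
  | app t u => FV t ∪ FV u

end Term

/-! ## Typing -/

/-- The declared types of constructors and function symbols. -/
structure Sig (S C F : Type) where
  tyC : C → Ty S
  tyF : F → Ty S

/-- Extension of an environment with a type for the variable bound by an abstraction. -/
def envCons {X : Type*} (U : X) (Γ : ℕ → Option X) : ℕ → Option X
  | 0 => some U
  | n + 1 => Γ n

/-- Environments are partial maps with a finite domain. -/
def FiniteEnv {X : Type*} (Γ : ℕ → Option X) : Prop := {x | Γ x ≠ none}.Finite

/-- The typing rules of the simply-typed λ-calculus with constants. -/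
inductive HasType {S C F : Type} (Sg : Sig S C F) :
    (ℕ → Option (Ty S)) → Term S C F → Ty S → Prop
  | var {Γ x T} : Γ x = some T → HasType Sg Γ (Term.var x) T
  | con {Γ c} : HasType Sg Γ (Term.con c) (Sg.tyC c)
  | fn {Γ f} : HasType Sg Γ (Term.fn f) (Sg.tyF f)
  | lam {Γ U V t} : HasType Sg (envCons U Γ) t V → HasType Sg Γ (Term.lam U t) (Ty.arrow U V)
  | app {Γ U V t u} : HasType Sg Γ t (Ty.arrow U V) → HasType Sg Γ u U →
      HasType Sg Γ (Term.app t u) V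

/-- The well-typed terms. -/
def WellTyped {S C F : Type} (Sg : Sig S C F) (t : Term S C F) : Prop :=
  ∃ (Γ : ℕ → Option (Ty S)) (T : Ty S), FiniteEnv Γ ∧ HasType Sg Γ t T

/-! ## Rewriting -/

section Rewriting
variable {S C F : Type}

/-- β-rewriting. -/
inductive BetaStep : Term S C F → Term S C F → Prop
  | beta (U : Ty S) (t u : Term S C F) :
      BetaStep (Term.app (Term.lam U t) u) (t.subst (Term.inst u))
  | appL {t t' : Term S C F} (u : Term S C F) :
      BetaStep t t' → BetaStep (Term.app t u) (Term.app t' u)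
  | appR (u : Term S C F) {t t' : Term S C F} :
      BetaStep t t' → BetaStep (Term.app u t) (Term.app u t')
  | lam (U : Ty S) {t t' : Term S C F} :
      BetaStep t t' → BetaStep (Term.lam U t) (Term.lam U t')

/-- The smallest relation that contains the rules `R`, is stable by substitution, and is
monotone (closed by contexts). -/
inductive RwStep (R : Set (Term S C F × Term S C F)) : Term S C F → Term S C F → Prop
  | rule {l r : Term S C F} (θ : ℕ → Term S C F) :
      (l, r) ∈ R → RwStep R (l.subst θ) (r.subst θ)
  | appL {t t' : Term S C F} (u : Term S C F) :
      RwStep R t t' → RwStep R (Term.app t u) (Term.app t' u)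
  | appR (u : Term S C F) {t t' : Term S C F} :
      RwStep R t t' → RwStep R (Term.app u t) (Term.app u t')
  | lam (U : Ty S) {t t' : Term S C F} :
      RwStep R t t' → RwStep R (Term.lam U t) (Term.lam U t')

/-- `l → r` is a rewrite rule: `l = f l₁ … lₙ` is typable, `FV(r) ⊆ FV(l)`, and `r` has every
type that `l` has. -/
def IsRule (Sg : Sig S C F) (l r : Term S C F) : Prop :=
  (∃ (f : F) (ls : List (Term S C F)), l = Term.apps (Term.fn f) ls) ∧
  r.FV ⊆ l.FV ∧
  (∃ (Δ : ℕ → Option (Ty S)) (T : Ty S), FiniteEnv Δ ∧ HasType Sg Δ l T) ∧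
  ∀ (Γ : ℕ → Option (Ty S)) (U : Ty S), FiniteEnv Γ → HasType Sg Γ l U → HasType Sg Γ r U

/-- A relation is finitely branching if every term has finitely many immediate reducts. -/
def FinitelyBranching (rel : Term S C F → Term S C F → Prop) : Prop :=
  ∀ t, {t' | rel t t'}.Finite

variable (R : Set (Term S C F × Term S C F))

/-- The union of β-rewriting and of rewriting with `R`. -/
def Step (t u : Term S C F) : Prop := BetaStep t u ∨ RwStep R t u

/-- Zero or more steps. -/
def Steps : Term S C F → Term S C F → Prop := Relation.ReflTransGen (Step R)

/-- Strong normalization: no infinite sequence of steps starts from `t`. -/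
def SN (t : Term S C F) : Prop := Acc (fun u v => Step R v u) t

/-! ## Computability -/

/-- Neutral terms. -/
def Neutral (t : Term S C F) : Prop :=
  (∃ (x : ℕ) (vs : List (Term S C F)), t = Term.apps (Term.var x) vs) ∨
  (∃ (U : Ty S) (b u : Term S C F) (vs : List (Term S C F)),
    t = Term.apps (Term.app (Term.lam U b) u) vs) ∨
  (∃ (f : F) (ts : List (Term S C F)), t = Term.apps (Term.fn f) ts ∧
    ∀ (ls : List (Term S C F)) (r : Term S C F),
      (Term.apps (Term.fn f) ls, r) ∈ R → ls.length ≤ ts.length)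

/-- Computability predicates. -/
def IsCP (P : Set (Term S C F)) : Prop :=
  (∀ t ∈ P, SN R t) ∧
  (∀ t ∈ P, ∀ u, Step R t u → u ∈ P) ∧
  (∀ t, Neutral R t → (∀ u, Step R t u → u ∈ P) → t ∈ P)

/-- Least upper bound in the complete lattice of computability predicates. -/
def lub (Q : Set (Set (Term S C F))) : Set (Term S C F) :=
  {t | ∀ P, IsCP R P → (∀ X ∈ Q, X ⊆ P) → t ∈ P}

/-- Extension of an interpretation of sorts to types. -/
def interp (I : S → Set (Term S C F)) : Ty S → Set (Term S C F)
  | Ty.base B => I B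
  | Ty.arrow U V => {t | ∀ u ∈ interp I U, Term.app t u ∈ interp I V}

/-- `[B : X, I]`: the interpretation that maps `B` to `X` and agrees with `I` elsewhere. -/
noncomputable def override (I : S → Set (Term S C F)) (B : S) (X : Set (Term S C F)) :
    S → Set (Term S C F) := Function.update I B X

end Rewriting

/-- `t` reduces to `c t₁ … tᵣ`, where `c : T₁ → ⋯ → Tᵣ → B` is maximally applied. -/
def ReducesToCon {S C F : Type} (Sg : Sig S C F) (R : Set (Term S C F × Term S C F)) (B : S)
    (t : Term S C F) (c : C) (ts : List (Term S C F)) : Prop :=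
  (Sg.tyC c).resSort = B ∧ ts.length = (Sg.tyC c).arity ∧
    Steps R t (Term.apps (Term.con c) ts)

/-- The choice, for every constructor `c`, of numbers `p c ≤ q c` such that the arguments
`0, …, p c - 1` are recursive and accessible, and the arguments `p c, …, q c - 1` are accessible
and not recursive. -/
structure AccArgs {S C F : Type} [PartialOrder S] (Sg : Sig S C F) where
  p : C → ℕ
  q : C → ℕ
  p_le : ∀ c, p c ≤ q c
  q_le : ∀ c, q c ≤ (Sg.tyC c).arity
  accessible : ∀ c k, k < q c →
    ((Sg.tyC c).argTy k).PositiveWrt (Sg.tyC c).resSort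
  recursive : ∀ c k, k < p c →
    ((Sg.tyC c).argTy k).occ (Sg.tyC c).resSort ≠ ∅
  nonrecursive : ∀ c k, p c ≤ k → k < q c →
    ((Sg.tyC c).argTy k).occ (Sg.tyC c).resSort = ∅

section Interpretation
variable {S C F : Type} [PartialOrder S] [WellFoundedLT S]
variable {Sg : Sig S C F} (R : Set (Term S C F × Term S C F)) (AA : AccArgs Sg)

/-- The operator `H` whose least fixpoint is the interpretation of the sort `B`, given an
interpretation `I` of the smaller sorts. -/
def sortOp (B : S) (I : S → Set (Term S C F)) (X : Set (Term S C F)) : Set (Term S C F) :=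
  {t | SN R t ∧ ∀ c ts, ReducesToCon Sg R B t c ts →
    ∀ k < AA.q c, Term.nth ts k ∈ interp (override I B X) ((Sg.tyC c).argTy k)}

/-- The least fixpoint of a monotone operator on sets of terms, as the intersection of its
pre-fixpoints. -/
def leastFix (Φ : Set (Term S C F) → Set (Term S C F)) : Set (Term S C F) :=
  ⋂₀ {X | Φ X ⊆ X}

/-- The interpretation of sorts, by well-founded induction on sorts. -/
noncomputable def sortInterp : S → Set (Term S C F) :=
  (wellFounded_lt (α := S)).fix fun B ih =>
    leastFix (sortOp R AA B fun D => if h : D < B then ih D h else ∅)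

end Interpretation

/-! ## Ordinals -/

/-- The smallest ordinal whose elements cannot be injected into the set of sets of terms:
the successor cardinal of the cardinality of that set. -/
noncomputable def kh (S C F : Type) : Ordinal.{0} :=
  (Order.succ (Cardinal.mk (Set (Term S C F)))).ord

/-- The ordinals smaller than `kh`. -/
abbrev Kh (S C F : Type) : Type 1 := Set.Iio (kh S C F)

theorem kh_pos (S C F : Type) : 0 < kh S C F := by
  have h : (0 : Cardinal) < Order.succ (Cardinal.mk (Set (Term S C F))) :=
    lt_of_le_of_lt bot_le (Order.lt_succ _)
  simpa only [kh, Cardinal.lt_ord, Ordinal.card_zero] using h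

/-- An ordinal injects into the set of sets of terms if and only if it is smaller than `kh`. -/
theorem lt_kh_iff (S C F : Type) (o : Ordinal.{0}) :
    o < kh S C F ↔ Nonempty (o.ToType ↪ Set (Term S C F)) := by
  rw [kh, Cardinal.lt_ord, Order.lt_succ_iff, ← Cardinal.mk_toType, Cardinal.le_def]

noncomputable instance (S C F : Type) : OrderBot (Kh S C F) where
  bot := ⟨0, kh_pos S C F⟩
  bot_le a := bot_le (a := a.1)

/-! ## Size algebras -/

/-- First-order terms over size variables `SV` and size function symbols `SF`. -/
inductive SExp (SV SF : Type*) (ar : SF → ℕ)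
  | var : SV → SExp SV SF ar
  | app : (g : SF) → (Fin (ar g) → SExp SV SF ar) → SExp SV SF ar

namespace SExp
variable {SV SF : Type*} {ar : SF → ℕ}

/-- Substitution of size variables. -/
def subst (φ : SV → SExp SV SF ar) : SExp SV SF ar → SExp SV SF ar
  | var v => φ v
  | app g b => app g fun i => (b i).subst φ

/-- Substitution of size variables by elements of the top-extension, in which `none` stands for
`∞`: the result is `∞` as soon as some variable of the expression is mapped to `∞`. -/
noncomputable def substTop (ψ : SV → Option (SExp SV SF ar)) :
    SExp SV SF ar → Option (SExp SV SF ar)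
  | var v => ψ v
  | app g b =>
    if h : ∀ i, ((b i).substTop ψ).isSome then some (app g fun i => ((b i).substTop ψ).get (h i))
    else none

/-- The variables of a size expression. -/
def vars : SExp SV SF ar → Set SV
  | var v => {v}
  | app _ b => {v | ∃ i, v ∈ (b i).vars}

/-- The interpretation in ordinals with respect to a valuation. -/
def eval {K : Type*} (J : ∀ g, (Fin (ar g) → K) → K) (μ : SV → K) : SExp SV SF ar → K
  | var v => μ v
  | app g b => J g fun i => (b i).eval J μ

/-- The set `Pos(v, a)` of the positions of the variable `v` in a size expression. -/
def occ (v : SV) : SExp SV SF ar → Set (List ℕ)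
  | var w => {p | p = [] ∧ w = v}
  | app _ b => {p | ∃ i p', p = (i.val + 1) :: p' ∧ p' ∈ (b i).occ v}

end SExp

/-- A size algebra, interpreted in the ordinals smaller than `kh`. -/
structure SizeAlg (S C F : Type) (SV SF : Type*) where
  ar : SF → ℕ
  le : SExp SV SF ar → SExp SV SF ar → Prop
  lt : SExp SV SF ar → SExp SV SF ar → Prop
  le_refl : ∀ a, le a a
  le_trans : ∀ a b d, le a b → le b d → le a d
  le_stable : ∀ (φ : SV → SExp SV SF ar) a b, le a b → le (a.subst φ) (b.subst φ)
  lt_irrefl : ∀ a, ¬ lt a a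
  lt_trans : ∀ a b d, lt a b → lt b d → lt a d
  lt_stable : ∀ (φ : SV → SExp SV SF ar) a b, lt a b → lt (a.subst φ) (b.subst φ)
  lt_le : ∀ a b, lt a b → le a b
  /-- the interpretation of the size function symbols -/
  J : ∀ g, (Fin (ar g) → Kh S C F) → Kh S C F
  le_sound : ∀ (μ : SV → Kh S C F) a b, le a b → a.eval J μ ≤ b.eval J μ
  lt_sound : ∀ (μ : SV → Kh S C F) a b, lt a b → a.eval J μ < b.eval J μ

namespace SizeAlg
variable {S C F : Type} {SV SF : Type*} (Al : SizeAlg S C F SV SF)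

/-- The finite size expressions. -/
abbrev E : Type _ := SExp SV SF Al.ar

/-- The quasi-order of the top-extension (`none` stands for `∞`). -/
def leTop (a b : Option Al.E) : Prop :=
  b = none ∨ ∃ a' b', a = some a' ∧ b = some b' ∧ Al.le a' b'

/-- The arguments in which `g` is monotone: with respect to the quasi-order on size expressions,
and in its interpretation. -/
def MonPos (g : SF) : Set (Fin (Al.ar g)) :=
  {i | (∀ (e : Fin (Al.ar g) → Al.E) (a b : Al.E), Al.le a b →
      Al.le (SExp.app g (Function.update e i a)) (SExp.app g (Function.update e i b))) ∧
    ∀ (e : Fin (Al.ar g) → Kh S C F) (a b : Kh S C F), a ≤ b →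
      Al.J g (Function.update e i a) ≤ Al.J g (Function.update e i b)}

/-- The arguments in which `g` is anti-monotone: with respect to the quasi-order on size
expressions, and in its interpretation. -/
def MonNeg (g : SF) : Set (Fin (Al.ar g)) :=
  {i | (∀ (e : Fin (Al.ar g) → Al.E) (a b : Al.E), Al.le a b →
      Al.le (SExp.app g (Function.update e i b)) (SExp.app g (Function.update e i a))) ∧
    ∀ (e : Fin (Al.ar g) → Kh S C F) (a b : Kh S C F), a ≤ b →
      Al.J g (Function.update e i b) ≤ Al.J g (Function.update e i a)}

/-- The positive (`s = true`) and negative (`s = false`) positions of a size expression. -/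
def pos : Bool → Al.E → Set (List ℕ)
  | s, SExp.var _ => {p | p = [] ∧ s = true}
  | s, SExp.app g b =>
    {p | (Al.ar g = 0 ∧ p = [] ∧ s = true) ∨
      ∃ i p', p = (i.val + 1) :: p' ∧
        ((i ∈ Al.MonPos g ∧ p' ∈ pos s (b i)) ∨ (i ∈ Al.MonNeg g ∧ p' ∈ pos (!s) (b i)))}

/-- The size variable `v` occurs only positively in `a` (possibly not at all); there is no
occurrence in `∞`. -/
def OnlyPos (v : SV) (a : Option Al.E) : Prop :=
  ∀ e, a = some e → e.occ v ⊆ Al.pos true e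

end SizeAlg

/-! ## Annotated types -/

/-- Size-annotated types over annotations in `Option E`: `base B (some a)` is the sort `B`
annotated with `a`, and `base B none` is the sort `B` annotated with `∞`, which is identified
with the sort `B` without annotation. -/
inductive ATy (S : Type) (E : Type*)
  | base : S → Option E → ATy S E
  | arrow : ATy S E → ATy S E → ATy S E

/-- A simple type as an annotated type. -/
def Ty.embed {S : Type} {E : Type*} : Ty S → ATy S E
  | Ty.base B => ATy.base B none
  | Ty.arrow U V => ATy.arrow U.embed V.embed

/-- `An(T, B, a)`: every occurrence of `B` in `T` is annotated with `a`. -/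
noncomputable def Ty.annot {S : Type} {E : Type*} (B : S) (a : Option E) : Ty S → ATy S E
  | Ty.base D => ATy.base D (if D = B then a else none)
  | Ty.arrow U V => ATy.arrow (U.annot B a) (V.annot B a)

/-- The annotated type obtained from `T₁ → ⋯ → Tᵣ → B` by replacing each `Tᵢ` with `args i`
(`i` counted from `0`) and annotating the final `B` with `σ`. -/
def Ty.annotWith {S : Type} {E : Type*} (σ : Option E) : (ℕ → ATy S E) → Ty S → ATy S E
  | _, Ty.base B => ATy.base B σ
  | args, Ty.arrow _ V => ATy.arrow (args 0) (V.annotWith σ fun i => args (i + 1))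

namespace ATy
variable {S : Type} {E : Type*}

/-- Erasure of the annotations. -/
def erase : ATy S E → Ty S
  | base B _ => Ty.base B
  | arrow U V => Ty.arrow U.erase V.erase

/-- `V₁ → ⋯ → Vₙ → V`. -/
def arrows (Vs : List (ATy S E)) (V : ATy S E) : ATy S E := Vs.foldr arrow V

/-- The type that remains after `n` arguments. -/
def dropArgs : ℕ → ATy S E → ATy S E
  | 0, T => T
  | _ + 1, base B a => base B a
  | n + 1, arrow _ V => dropArgs n V

/-- Substitution of size variables, by elements of the top-extension. -/
noncomputable def subst {SV SF : Type*} {ar : SF → ℕ} (ψ : SV → Option (SExp SV SF ar)) :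
    ATy S (SExp SV SF ar) → ATy S (SExp SV SF ar)
  | base B a => base B (a.bind fun e => e.substTop ψ)
  | arrow U V => arrow (U.subst ψ) (V.subst ψ)

end ATy

/-- Subtyping. -/
inductive Sub {S C F : Type} {SV SF : Type*} (Al : SizeAlg S C F SV SF) :
    ATy S Al.E → ATy S Al.E → Prop
  | size {B a b} : Al.leTop a b → Sub Al (ATy.base B a) (ATy.base B b)
  | prod {U U' V V'} : Sub Al U' U → Sub Al V V' → Sub Al (ATy.arrow U V) (ATy.arrow U' V')
  | refl {T} : Sub Al T T
  | trans {T U V} : Sub Al T U → Sub Al U V → Sub Al T V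

/-! ## Annotated types of constructors and stratifications -/

/-- Annotated types of constructors: the argument `i < q c` of the constructor
`c : T₁ → ⋯ → Tᵣ → B` gets the type `An(Tᵢ, srt c i, α c i)`, and the result sort gets the
annotation `σ c`, where `none` stands for `∞`. -/
structure ConAnnot {S C F : Type} {SV SF : Type*} [PartialOrder S] (Sg : Sig S C F)
    (Al : SizeAlg S C F SV SF) extends AccArgs Sg where
  srt : C → ℕ → S
  α : C → ℕ → Option SV
  σ : C → Option Al.E
  α_rec : ∀ c i, i < p c → α c i ≠ none
  α_eq_or_distinct : ∀ c,
    (∀ i j v w, i < q c → j < q c → α c i = some v → α c j = some w → v = w) ∨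
    (∀ i j v w, i < q c → j < q c → i ≠ j → α c i = some v → α c j = some w → v ≠ w)
  srt_rec : ∀ c i, i < p c → srt c i = (Sg.tyC c).resSort
  srt_occ : ∀ c i, p c ≤ i → i < q c → α c i ≠ none →
    ((Sg.tyC c).argTy i).occ (srt c i) ≠ ∅
  srt_pos : ∀ c i, p c ≤ i → i < q c → α c i ≠ none →
    ((Sg.tyC c).argTy i).OnlyPos (srt c i)
  /-- `σ c` is monotone with respect to every size variable -/
  σ_mon : ∀ c v, Al.OnlyPos v (σ c)
  /-- `σ c`, when finite, is strictly extensive with respect to recursive arguments -/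
  σ_ext : ∀ c i v a, i < p c → α c i = some v → σ c = some a → Al.lt (SExp.var v) a

namespace ConAnnot
variable {S C F : Type} {SV SF : Type*} [PartialOrder S] {Sg : Sig S C F}
  {Al : SizeAlg S C F SV SF} (CA : ConAnnot Sg Al)

/-- The annotated type of the argument of index `i` of `c`. -/
noncomputable def argATy (c : C) (i : ℕ) : ATy S Al.E :=
  if i < CA.q c then
    ((Sg.tyC c).argTy i).annot (CA.srt c i) ((CA.α c i).map SExp.var)
  else ((Sg.tyC c).argTy i).embed

/-- The annotated type of `c`. -/
noncomputable def aty (c : C) : ATy S Al.E :=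
  (Sg.tyC c).annotWith (CA.σ c) (CA.argATy c)

/-- The valuation that maps a size variable `v` to the supremum of the sizes `κ i` of the
accessible arguments annotated with `v` (hence to `κ i` if `i` is the only one, and to `0` if
there is none). -/
noncomputable def valuation (c : C) (κ : ℕ → Kh S C F) (v : SV) : Kh S C F :=
  ((Finset.range (CA.q c)).filter fun i => CA.α c i = some v).sup κ

/-- The size function of `c`. -/
noncomputable def sizeFun (c : C) (κ : ℕ → Kh S C F) : Kh S C F :=
  match CA.σ c with
  | none => ⊥
  | some a => a.eval Al.J (CA.valuation c κ)

end ConAnnot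

section Stratification
variable {S C F : Type} {SV SF : Type*} [PartialOrder S] [WellFoundedLT S]
  {Sg : Sig S C F} {Al : SizeAlg S C F SV SF}

/-- The size of `t` in a family of sets indexed by ordinals: the smallest index `κ` such that
`t` belongs to the set of index `κ` (only used when there is one). -/
noncomputable def osize (fam : Kh S C F → Set (Term S C F)) (t : Term S C F) : Kh S C F :=
  if h : ∃ κ, t ∈ fam κ then (wellFounded_lt (α := Kh S C F)).min {κ | t ∈ fam κ} h else ⊥

variable (R : Set (Term S C F × Term S C F)) (CA : ConAnnot Sg Al)

/-- One stage of the stratification of the sort `B`: `lower` gives the stratifications of the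
smaller sorts and `prev` the previous stages. At an infinite limit ordinal, take the least upper
bound of the previous stages. At `0` and at successor ordinals `β + 1`, take the strongly
normalizing terms `t` such that, whenever `t` reduces to a maximally applied `c t₁ … tᵣ` of sort
`B`, the recursive accessible arguments are in stage `β` (so there is none at stage `0`), the
other accessible arguments are computable, and the size function of `c`, applied to the sizes of
the accessible arguments, is bounded by the stage. -/
noncomputable def stratStep (B : S) (lower : ∀ D, D < B → Kh S C F → Set (Term S C F))
    (κ : Kh S C F) (prev : ∀ β, β < κ → Set (Term S C F)) : Set (Term S C F) :=
  let I := sortInterp R CA.toAccArgs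
  if Order.IsSuccLimit κ.1 then lub R {X | ∃ β h, X = prev β h}
  else {t | SN R t ∧ ∀ c ts, ReducesToCon Sg R B t c ts →
    (∀ k < CA.p c, ∃ (β : Kh S C F) (h : β < κ), κ.1 = Order.succ β.1 ∧
      Term.nth ts k ∈ interp (override I B (prev β h)) ((Sg.tyC c).argTy k)) ∧
    (∀ k, CA.p c ≤ k → k < CA.q c → Term.nth ts k ∈ interp I ((Sg.tyC c).argTy k)) ∧
    CA.sizeFun c (fun k =>
      if k < CA.p c then
        osize (fun β => {u | ∃ h : β < κ,
          u ∈ interp (override I B (prev β h)) ((Sg.tyC c).argTy k)}) (Term.nth ts k)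
      else if h : CA.srt c k < B then
        osize (fun β => interp (override I (CA.srt c k) (lower (CA.srt c k) h β))
          ((Sg.tyC c).argTy k)) (Term.nth ts k)
      else ⊥) ≤ κ}

/-- The stratification of sorts defined by the size functions of constructors. -/
noncomputable def strat : S → Kh S C F → Set (Term S C F) :=
  (wellFounded_lt (α := S)).fix fun B lower =>
    (wellFounded_lt (α := Kh S C F)).fix fun κ prev => stratStep R CA B lower κ prev

/-- The size of a term of type `T`, measured with respect to the sort `B`, that is, its size in
the stratification `[B : strat B] T` of `T`. -/
noncomputable def sizeIn (B : S) (T : Ty S) (t : Term S C F) : Kh S C F :=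
  osize (fun κ => interp (override (sortInterp R CA.toAccArgs) B (strat R CA B κ)) T) t

theorem strat_eq (B : S) (κ : Kh S C F) :
    strat R CA B κ =
      stratStep R CA B (fun D _ => strat R CA D) κ (fun β _ => strat R CA B β) := by
  have h1 : ∀ B, strat R CA B = (wellFounded_lt (α := Kh S C F)).fix fun κ prev =>
      stratStep R CA B (fun D _ => strat R CA D) κ prev := fun B => by
    unfold strat
    rw [WellFounded.fix_eq]
  rw [h1 B, WellFounded.fix_eq]

theorem sortInterp_eq (AA : AccArgs Sg) (B : S) :
    sortInterp R AA B =
      leastFix (sortOp R AA B fun D => if D < B then sortInterp R AA D else ∅) := by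
  unfold sortInterp
  rw [WellFounded.fix_eq]
  simp only [dite_eq_ite]

/-- `Accessible CA u U D t T B`: the triple `(u, U, D)` is accessible in `(t, T, B)`. -/
inductive Accessible {S C F : Type} {SV SF : Type*} [PartialOrder S] {Sg : Sig S C F}
    {Al : SizeAlg S C F SV SF} (CA : ConAnnot Sg Al) (u : Term S C F) (U : Ty S) (D : S) :
    Term S C F → Ty S → S → Prop
  | refl : Accessible CA u U D u U D
  | step {c : C} {ts : List (Term S C F)} {B : S} {k : ℕ} :
      (Sg.tyC c).resSort = B → ts.length = (Sg.tyC c).arity → k < CA.q c →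
      Accessible CA u U D (Term.nth ts k) ((Sg.tyC c).argTy k) (CA.srt c k) →
      Accessible CA u U D (Term.apps (Term.con c) ts) (Ty.base B) B

end Stratification

/-! ## Annotated types of function symbols and order on function calls -/

/-- `x` and `y` are related by `r` in exactly one coordinate and equal in the others. -/
def ProdRel {n : ℕ} {X : Type*} (r : X → X → Prop) (x y : Fin n → X) : Prop :=
  ∃ i, r (x i) (y i) ∧ ∀ j, j ≠ i → x j = y j

/-- Annotated types of function symbols and parameters of the order on function calls. The
precedence on function symbols is the quasi-order on `F`; function symbols `f` and `g` are
equivalent if `g ≤ f` and `f ≤ g`. The domains of comparison of all function symbols are taken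
in a common type `DA` (for tuples of size expressions) or `DK` (for tuples of ordinals). -/
structure FunAnnot {S C F : Type} {SV SF : Type*} [Preorder F] (Sg : Sig S C F)
    (Al : SizeAlg S C F SV SF) (DA DK : Type*) where
  q : F → ℕ
  q_le : ∀ f, q f ≤ (Sg.tyF f).arity
  arg_sort : ∀ f i, i < q f → ∃ B, (Sg.tyF f).argTy i = Ty.base B
  α : ∀ f, Fin (q f) → SV
  α_inj : ∀ f, Function.Injective (α f)
  σ : F → Option Al.E
  σ_vars : ∀ f a, σ f = some a → a.vars ⊆ Set.range (α f)
  leA : F → DA → DA → Prop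
  ltA : F → DA → DA → Prop
  leA_refl : ∀ f x, leA f x x
  leA_trans : ∀ f x y z, leA f x y → leA f y z → leA f x z
  ltA_leA : ∀ f x y, ltA f x y → leA f x y
  ltA_wf : ∀ f, WellFounded (ltA f)
  ζA : ∀ f, (Fin (q f) → Al.E) → DA
  leK : F → DK → DK → Prop
  ltK : F → DK → DK → Prop
  leK_refl : ∀ f x, leK f x x
  leK_trans : ∀ f x y z, leK f x y → leK f y z → leK f x z
  ltK_leK : ∀ f x y, ltK f x y → leK f x y
  ltK_wf : ∀ f, WellFounded (ltK f)
  ζK : ∀ f, (Fin (q f) → Kh S C F) → DK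
  eqv : ∀ f g, f ≤ g → g ≤ f → leA f = leA g ∧ ltA f = ltA g ∧ leK f = leK g ∧ ltK f = ltK g
  sound : ∀ g f (a : Fin (q g) → Al.E) (b : Fin (q f) → Al.E), g ≤ f → f ≤ g →
    ltA f (ζA g a) (ζA f b) → ∀ μ : SV → Kh S C F,
      ltK f (ζK g fun i => (a i).eval Al.J μ) (ζK f fun i => (b i).eval Al.J μ)
  compatA : ∀ g f (a b : Fin (q g) → Al.E) (d : Fin (q f) → Al.E), g ≤ f → f ≤ g →
    ProdRel Al.le a b → ltA f (ζA g b) (ζA f d) → ltA f (ζA g a) (ζA f d)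
  compatK : ∀ g f (x : Fin (q g) → Kh S C F) (y z : Fin (q f) → Kh S C F), g ≤ f → f ≤ g →
    ltK f (ζK g x) (ζK f y) → ProdRel (· ≤ ·) y z → ltK f (ζK g x) (ζK f z)

namespace FunAnnot
variable {S C F : Type} {SV SF DA DK : Type*} [Preorder F] {Sg : Sig S C F}
  {Al : SizeAlg S C F SV SF} (FA : FunAnnot Sg Al DA DK)

/-- The annotated type of the argument of index `i` of `f`. -/
noncomputable def argATy (f : F) (i : ℕ) : ATy S Al.E :=
  if h : i < FA.q f then
    ((Sg.tyF f).argTy i).annot ((Sg.tyF f).argTy i).resSort (some (SExp.var (FA.α f ⟨i, h⟩)))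
  else ((Sg.tyF f).argTy i).embed

/-- The annotated type of `f`. -/
noncomputable def aty (f : F) : ATy S Al.E :=
  (Sg.tyF f).annotWith (FA.σ f) (FA.argATy f)

/-- The order on tuples of size expressions, for the symbols `g` and `f`. -/
def CallLt (g f : F) (a : Fin (FA.q g) → Al.E) (b : Fin (FA.q f) → Al.E) : Prop :=
  (g ≤ f ∧ f ≤ g) ∧ FA.ltA f (FA.ζA g a) (FA.ζA f b)

end FunAnnot

/-- The computability closure of `(f, φ)`, that is, the size-annotated typing relation of the
termination criterion. The rule for applications is split according to the head: variables are
used with their type in the environment, constructors and function symbols with any instance `ψ`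
of their annotated type; `φ` matters only on the size variables of `f`. -/
inductive Clos {S C F : Type} {SV SF DA DK : Type*} [PartialOrder S] [Preorder F]
    {Sg : Sig S C F} {Al : SizeAlg S C F SV SF} (CA : ConAnnot Sg Al)
    (FA : FunAnnot Sg Al DA DK) (f : F) (φ : SV → Al.E) :
    (ℕ → Option (ATy S Al.E)) → Term S C F → ATy S Al.E → Prop
  | appVar {Γ : ℕ → Option (ATy S Al.E)} {x : ℕ} {Vs : List (ATy S Al.E)} {V : ATy S Al.E}
      {ws : List (Term S C F)} :
      Γ x = some (ATy.arrows Vs V) → ws.length = Vs.length →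
      (∀ (i : ℕ) (w : Term S C F) (W : ATy S Al.E), ws[i]? = some w → Vs[i]? = some W →
        Clos CA FA f φ Γ w W) →
      Clos CA FA f φ Γ (Term.apps (Term.var x) ws) V
  | appCon {Γ : ℕ → Option (ATy S Al.E)} {c : C} {Vs : List (ATy S Al.E)} {V : ATy S Al.E}
      {ws : List (Term S C F)} (ψ : SV → Option Al.E) :
      CA.aty c = ATy.arrows Vs V → ws.length = Vs.length →
      (∀ (i : ℕ) (w : Term S C F) (W : ATy S Al.E), ws[i]? = some w → Vs[i]? = some W →
        Clos CA FA f φ Γ w (W.subst ψ)) →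
      Clos CA FA f φ Γ (Term.apps (Term.con c) ws) (V.subst ψ)
  | appFn {Γ : ℕ → Option (ATy S Al.E)} {h : F} {Vs : List (ATy S Al.E)} {V : ATy S Al.E}
      {ws : List (Term S C F)} (ψ : SV → Option Al.E) :
      FA.aty h = ATy.arrows Vs V → ws.length = Vs.length →
      (h < f ∨ ((h ≤ f ∧ f ≤ h) ∧ FA.q h ≤ Vs.length)) →
      (h < f ∨ ∃ a : Fin (FA.q h) → Al.E, (∀ i, ψ (FA.α h i) = some (a i)) ∧
        FA.CallLt h f a fun i => φ (FA.α f i)) →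
      (∀ (i : ℕ) (w : Term S C F) (W : ATy S Al.E), ws[i]? = some w → Vs[i]? = some W →
        Clos CA FA f φ Γ w (W.subst ψ)) →
      Clos CA FA f φ Γ (Term.apps (Term.fn h) ws) (V.subst ψ)
  | lam {Γ : ℕ → Option (ATy S Al.E)} {U : Ty S} {V : ATy S Al.E} {w : Term S C F} :
      Clos CA FA f φ (envCons U.embed Γ) w V →
      Clos CA FA f φ Γ (Term.lam U w) (ATy.arrow U.embed V)
  | sub {Γ : ℕ → Option (ATy S Al.E)} {t : Term S C F} {U V : ATy S Al.E} :
      Clos CA FA f φ Γ t U → Sub Al U V → Clos CA FA f φ Γ t V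

/-! ## The conditions of the termination criterion -/

section Criterion
variable {S C F : Type} {SV SF DA DK : Type*} [PartialOrder S] [WellFoundedLT S] [Preorder F]
  {Sg : Sig S C F} {Al : SizeAlg S C F SV SF}
  (R : Set (Term S C F × Term S C F)) (CA : ConAnnot Sg Al) (FA : FunAnnot Sg Al DA DK)

/-- The environment `Γ` for the variables of `r`: for every variable `x` of type `U`, `x` occurs
in the argument of index `k x` of the left-hand side, the sort `Bx x` occurs only positively
in the erasure of `U`, and `U` is obtained by annotating this sort with the size variable `αx x`. -/
def GoodEnv (ls : List (Term S C F)) (r : Term S C F) (Γ : ℕ → Option (ATy S Al.E))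
    (k : ℕ → ℕ) (Bx : ℕ → S) (αx : ℕ → SV) : Prop :=
  (∀ x, Γ x ≠ none ↔ x ∈ r.FV) ∧
  ∀ x U, Γ x = some U →
    k x < ls.length ∧ x ∈ (Term.nth ls (k x)).FV ∧ U.erase.OnlyPos (Bx x) ∧
    U = U.erase.annot (Bx x) (some (SExp.var (αx x)))

/-- Monotony. -/
def Monotony (f : F) : Prop := ∀ i, Al.OnlyPos (FA.α f i) (FA.σ f)

/-- Accessibility. -/
def Accessibility (f : F) (ls : List (Term S C F)) (Γ : ℕ → Option (ATy S Al.E))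
    (k : ℕ → ℕ) (Bx : ℕ → S) (φ : SV → Al.E) : Prop :=
  ∀ x U, Γ x = some U →
    (Term.var x = Term.nth ls (k x) ∧ U = (FA.argATy f (k x)).subst fun v => some (φ v)) ∨
    ∃ B, (Sg.tyF f).argTy (k x) = Ty.base B ∧
      Accessible CA (Term.var x) U.erase (Bx x) (Term.nth ls (k x)) (Ty.base B) B

/-- Minimality. -/
def Minimality (f : F) (ls : List (Term S C F)) (Γ : ℕ → Option (ATy S Al.E))
    (Bx : ℕ → S) (αx : ℕ → SV) (φ : SV → Al.E) : Prop :=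
  ∀ θ : ℕ → Term S C F,
    (∀ i < ls.length,
      (Term.nth ls i).subst θ ∈ interp (sortInterp R CA.toAccArgs) ((Sg.tyF f).argTy i)) →
    ∃ ν : SV → Kh S C F,
      (∀ x U, Γ x = some U → sizeIn R CA (Bx x) U.erase (θ x) ≤ ν (αx x)) ∧
      ∀ i : Fin (FA.q f), (φ (FA.α f i)).eval Al.J ν =
        osize (strat R CA ((Sg.tyF f).argTy i).resSort) ((Term.nth ls i).subst θ)

/-- Subject-reduction and decreasingness. -/
def Decreasingness (f : F) (ls : List (Term S C F)) (r : Term S C F)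
    (Γ : ℕ → Option (ATy S Al.E)) (φ : SV → Al.E) : Prop :=
  Clos CA FA f φ Γ r (((FA.aty f).dropArgs ls.length).subst fun v => some (φ v))

/-- The conditions of the termination criterion for the rule `l → r`. -/
def RuleCriterion (l r : Term S C F) : Prop :=
  ∃ (f : F) (ls : List (Term S C F)), l = Term.apps (Term.fn f) ls ∧ FA.q f ≤ ls.length ∧
    ∃ (Γ : ℕ → Option (ATy S Al.E)) (k : ℕ → ℕ) (Bx : ℕ → S) (αx : ℕ → SV) (φ : SV → Al.E),
      GoodEnv ls r Γ k Bx αx ∧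
      Monotony FA f ∧
      Accessibility CA FA f ls Γ k Bx φ ∧
      Minimality R CA FA f ls Γ Bx αx φ ∧
      Decreasingness CA FA f ls r Γ φ

end Criterion

end SizeTermination

open SizeTermination

/-! The proof is the Tait–Girard computability method refined by ordinal sizes. A sort denotes a set
of strongly normalizing terms, an arrow type the corresponding function space, and every such
denotation is a computability predicate. So it is enough that a well-typed term belongs to the
denotation of its type (`HasType.mem_interp`). Application is immediate, abstraction is
`app_lam_mem`, and a constructor applied to computable arguments is computable. The real work lies
in the function symbols.

Sizes come from the stages `strat`, which approximate a sort from below. The stages increase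
(`strat_mono`), and `kh` is so large compared with the set of terms that some stage is the whole
sort (`exists_strat_eq_sortInterp`); hence every computable term has a size. Since a finite
annotation of a constructor strictly exceeds its recursive size variables, and size functions never
take limit values, a constructor application lies in the stage given by its size function
(`con_mem_strat`). This makes the annotated types of constructors sound. Subtyping is sound because
the stages increase.

For a function symbol `f` the claim, `fn_mem_aInterp`, is that for every valuation `μ` of its size
variables, arguments of sizes bounded by `μ` give a result of size bounded by the annotation of `f`
evaluated at `μ`. It is proved by well-founded induction on the precedence and, inside an
equivalence class, on the image of `μ` under `ζK`. A maximally applied `f` is neutral, so only its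
reducts matter. Steps inside the arguments are handled by an induction on these arguments. For a
rule instance at the head, minimality provides a valuation `ν` under which the size expressions `φ`
evaluate to the exact sizes of the arguments, hence to at most `μ`, and which bounds the sizes of
the variables of the right-hand side; accessibility makes these variables computable. Soundness of
the computability closure (`Clos.mem_aInterp`) then applies: the calls of symbols equivalent to `f`
are smaller because the symbolic decrease is sound and `ltK` tolerates larger right-hand arguments.
Monotony finally raises the bound on the result from `ν` to `μ`. -/

namespace SizeTermination

open Classical

/-! ## Substitution -/

namespace Term
variable {S C F : Type}

/-- The substitution that maps `0` to `u` and `n + 1` to `θ n`. -/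
def scons (u : Term S C F) (θ : ℕ → Term S C F) : ℕ → Term S C F
  | 0 => u
  | n + 1 => θ n

/-- The composition laws come in the order renaming/renaming, renaming/substitution,
substitution/renaming, substitution/substitution: crossing a binder in a later law requires earlier
ones, because `up` renames. -/
theorem rename_rename (ρ ρ' : ℕ → ℕ) (t : Term S C F) :
    (t.rename ρ).rename ρ' = t.rename fun n => ρ' (ρ n) := by
  induction t generalizing ρ ρ' with
  | lam U t ih =>
    simp only [rename, ih]
    congr 2
    funext n
    cases n <;> rfl
  | _ => simp_all [rename]

theorem subst_rename (ρ : ℕ → ℕ) (θ : ℕ → Term S C F) (t : Term S C F) :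
    (t.rename ρ).subst θ = t.subst fun n => θ (ρ n) := by
  induction t generalizing ρ θ with
  | lam U t ih =>
    simp only [rename, subst, ih]
    congr 2
    funext n
    cases n <;> rfl
  | _ => simp_all [rename, subst]

theorem rename_subst (ρ : ℕ → ℕ) (θ : ℕ → Term S C F) (t : Term S C F) :
    (t.subst θ).rename ρ = t.subst fun n => (θ n).rename ρ := by
  induction t generalizing ρ θ with
  | lam U t ih =>
    simp only [rename, subst, ih]
    congr 2
    funext n
    cases n with
    | zero => rfl
    | succ n => simp only [up, rename_rename]; rfl
  | _ => simp_all [rename, subst]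

theorem subst_subst (θ θ' : ℕ → Term S C F) (t : Term S C F) :
    (t.subst θ).subst θ' = t.subst fun n => (θ n).subst θ' := by
  induction t generalizing θ θ' with
  | lam U t ih =>
    simp only [subst, ih]
    congr 2
    funext n
    cases n with
    | zero => rfl
    | succ n => simp only [up, subst_rename, rename_subst]
  | _ => simp_all [subst]

theorem subst_var (t : Term S C F) : t.subst var = t := by
  induction t with
  | lam U t ih =>
    have : up (var : ℕ → Term S C F) = var := by
      funext n
      cases n <;> rfl
    simp only [subst, this, ih]
  | _ => simp_all [subst]

theorem subst_up_inst (θ : ℕ → Term S C F) (t u : Term S C F) :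
    (t.subst (up θ)).subst (inst u) = t.subst (scons u θ) := by
  rw [subst_subst]
  congr 1
  funext n
  cases n with
  | zero => rfl
  | succ n =>
    simp only [up, subst_rename, scons]
    exact subst_var _

/-- This commutation is what makes β-steps stable by substitution. -/
theorem subst_inst (θ : ℕ → Term S C F) (t u : Term S C F) :
    (t.subst (inst u)).subst θ = (t.subst (up θ)).subst (inst (u.subst θ)) := by
  rw [subst_up_inst, subst_subst]
  congr 1
  funext n
  cases n <;> rfl

/-! ## Applications to lists of arguments -/

theorem apps_append (t : Term S C F) (us vs : List (Term S C F)) :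
    t.apps (us ++ vs) = (t.apps us).apps vs := List.foldl_append

theorem apps_concat (t : Term S C F) (us : List (Term S C F)) (v : Term S C F) :
    t.apps (us ++ [v]) = app (t.apps us) v := apps_append t us [v]

theorem subst_apps (θ : ℕ → Term S C F) (t : Term S C F) (us : List (Term S C F)) :
    (t.apps us).subst θ = (t.subst θ).apps (us.map (subst θ)) := by
  induction us generalizing t with
  | nil => rfl
  | cons u us ih => exact ih (app t u)

/-- The head and the arguments of a term. -/
def spine : Term S C F → Term S C F × List (Term S C F)
  | app t u => ((spine t).1, (spine t).2 ++ [u])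
  | t => (t, [])

theorem spine_apps (t : Term S C F) (us : List (Term S C F)) :
    (t.apps us).spine = (t.spine.1, t.spine.2 ++ us) := by
  induction us generalizing t with
  | nil => simp [apps]
  | cons u us ih => exact (ih (app t u)).trans (by simp [spine])

theorem nth_lt {ts : List (Term S C F)} {k : ℕ} (h : k < ts.length) : nth ts k = ts[k] := by
  simp [nth, h]

end Term

open Term

/-! ## Inversion of rewriting steps -/

section Steps
variable {S C F : Type} {R : Set (Term S C F × Term S C F)}

/-- The left-hand sides of the rules are headed by function symbols. -/
def FnRules (R : Set (Term S C F × Term S C F)) : Prop :=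
  ∀ l r, (l, r) ∈ R → ∃ f ls, l = apps (fn f) ls

theorem BetaStep.subst {t u : Term S C F} (h : BetaStep t u) (θ : ℕ → Term S C F) :
    BetaStep (t.subst θ) (u.subst θ) := by
  induction h generalizing θ with
  | beta U t u => rw [subst_inst]; exact .beta _ _ _
  | appL u _ ih => exact .appL _ (ih θ)
  | appR u _ ih => exact .appR _ (ih θ)
  | lam U _ ih => exact .lam _ (ih _)

theorem RwStep.subst {t u : Term S C F} (h : RwStep R t u) (θ : ℕ → Term S C F) :
    RwStep R (t.subst θ) (u.subst θ) := by
  induction h generalizing θ with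
  | rule θ' h => rw [subst_subst, subst_subst]; exact .rule _ h
  | appL u _ ih => exact .appL _ (ih θ)
  | appR u _ ih => exact .appR _ (ih θ)
  | lam U _ ih => exact .lam _ (ih _)

theorem Step.subst {t u : Term S C F} (h : Step R t u) (θ : ℕ → Term S C F) :
    Step R (t.subst θ) (u.subst θ) := h.imp (·.subst θ) (·.subst θ)

theorem Step.appL {t t' : Term S C F} (h : Step R t t') (u : Term S C F) :
    Step R (app t u) (app t' u) := h.imp (·.appL u) (·.appL u)

/-- The possible redexes are a head β-redex, one inside the function, one inside the argument, and
the whole application as an instance of a left-hand side. -/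
theorem step_app_inv {a b u : Term S C F} (h : Step R (app a b) u) :
    (∃ U t, a = lam U t ∧ u = t.subst (inst b)) ∨
    (∃ a', Step R a a' ∧ u = app a' b) ∨ (∃ b', Step R b b' ∧ u = app a b') ∨
    ∃ l r θ, (l, r) ∈ R ∧ l.subst θ = app a b ∧ u = r.subst θ := by
  rcases h with h | h
  · cases h with
    | beta U t u => exact .inl ⟨_, _, rfl, rfl⟩
    | appL u h => exact .inr (.inl ⟨_, .inl h, rfl⟩)
    | appR u h => exact .inr (.inr (.inl ⟨_, .inl h, rfl⟩))
  · generalize hs : app a b = s at h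
    cases h with
    | rule θ h => exact .inr (.inr (.inr ⟨_, _, _, h, hs.symm ▸ rfl, rfl⟩))
    | appL u h => cases hs; exact .inr (.inl ⟨_, .inr h, rfl⟩)
    | appR u h => cases hs; exact .inr (.inr (.inl ⟨_, .inr h, rfl⟩))
    | lam => cases hs

theorem FnRules.spine_lhs (hR : FnRules R) {l r : Term S C F} (h : (l, r) ∈ R)
    (θ : ℕ → Term S C F) :
    ∃ f ls, l = apps (fn f) ls ∧ (l.subst θ).spine = (fn f, ls.map (Term.subst θ)) := by
  obtain ⟨f, ls, rfl⟩ := hR l r h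
  exact ⟨f, ls, rfl, by simp [subst_apps, spine_apps, Term.subst, spine]⟩

theorem step_lam_inv (hR : FnRules R) {U : Ty S} {t u : Term S C F}
    (h : Step R (lam U t) u) : ∃ t', Step R t t' ∧ u = lam U t' := by
  rcases h with h | h
  · cases h with
    | lam U h => exact ⟨_, .inl h, rfl⟩
  · generalize hs : lam U t = s at h
    cases h with
    | rule θ h =>
      obtain ⟨f, ls, _, h'⟩ := hR.spine_lhs h θ
      simp [← hs, spine] at h'
    | lam V h => cases hs; exact ⟨_, .inr h, rfl⟩
    | appL => cases hs
    | appR => cases hs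

theorem not_step_var (hR : FnRules R) {x : ℕ} {u : Term S C F} : ¬ Step R (var x) u := by
  rintro (h | h)
  · cases h
  · generalize hs : var x = s at h
    cases h with
    | rule θ h =>
      obtain ⟨f, ls, _, h'⟩ := hR.spine_lhs h θ
      simp [← hs, spine] at h'
    | _ => cases hs

theorem not_step_con (hR : FnRules R) {c : C} {u : Term S C F} : ¬ Step R (con c) u := by
  rintro (h | h)
  · cases h
  · generalize hs : con c = s at h
    cases h with
    | rule θ h =>
      obtain ⟨f, ls, _, h'⟩ := hR.spine_lhs h θ
      simp [← hs, spine] at h'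
    | _ => cases hs

theorem step_fn_inv {f : F} {u : Term S C F} (h : Step R (fn f) u) :
    ∃ l r θ, (l, r) ∈ R ∧ l.subst θ = fn f ∧ u = r.subst θ := by
  rcases h with h | h
  · cases h
  · generalize hs : fn f = s at h
    cases h with
    | rule θ h => exact ⟨_, _, θ, h, rfl, rfl⟩
    | _ => cases hs

/-- One step in one element of a list. -/
inductive ListStep (R : Set (Term S C F × Term S C F)) :
    List (Term S C F) → List (Term S C F) → Prop
  | head {t t' : Term S C F} (ts : List (Term S C F)) :
      Step R t t' → ListStep R (t :: ts) (t' :: ts)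
  | tail (t : Term S C F) {ts ts' : List (Term S C F)} :
      ListStep R ts ts' → ListStep R (t :: ts) (t :: ts')

theorem ListStep.append_right {ts ts' : List (Term S C F)} (h : ListStep R ts ts')
    (us : List (Term S C F)) : ListStep R (ts ++ us) (ts' ++ us) := by
  induction h with
  | head ts h => exact .head _ h
  | tail t _ ih => exact .tail _ ih

theorem ListStep.append_left {ts ts' : List (Term S C F)} (us : List (Term S C F))
    (h : ListStep R ts ts') : ListStep R (us ++ ts) (us ++ ts') := by
  induction us with
  | nil => exact h
  | cons u us ih => exact .tail _ ih

theorem ListStep.length_eq {ts ts' : List (Term S C F)} (h : ListStep R ts ts') :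
    ts'.length = ts.length := by
  induction h with
  | head => rfl
  | tail _ _ ih => simp [ih]

theorem ListStep.nth {ts ts' : List (Term S C F)} (h : ListStep R ts ts') (k : ℕ) :
    Term.nth ts' k = Term.nth ts k ∨ Step R (Term.nth ts k) (Term.nth ts' k) := by
  induction h generalizing k with
  | head ts h =>
    cases k with
    | zero => exact .inr h
    | succ k => exact .inl rfl
  | tail t _ ih =>
    cases k with
    | zero => exact .inl rfl
    | succ k => exact ih k

/-- Nested inductions: a step in the head keeps the tail accessible, and a step in the tail leaves
the head alone. -/
theorem acc_listStep (ts : List (Term S C F)) (h : ∀ k < ts.length, SN R (nth ts k)) :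
    Acc (fun us vs => ListStep R vs us) ts := by
  induction ts with
  | nil => exact ⟨_, fun us h => nomatch h⟩
  | cons t ts ih =>
    have ht : SN R t := h 0 (Nat.succ_pos _)
    have hts := ih fun k hk => h (k + 1) (Nat.succ_lt_succ hk)
    clear h ih
    induction ht generalizing ts with
    | intro t _ iht =>
      induction hts with
      | intro ts hts ihts =>
        refine ⟨_, fun us hus => ?_⟩
        cases hus with
        | head _ hs => exact iht _ hs _ ⟨ts, hts⟩
        | tail _ hs => exact ihts _ hs

/-- Instances of left-hand sides are headed by function symbols, so a term headed by a constructor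
has no redex at its head. -/
theorem step_apps_con (hR : FnRules R) {c : C} {ts : List (Term S C F)} {u : Term S C F}
    (h : Step R (apps (con c) ts) u) : ∃ ts', ListStep R ts ts' ∧ u = apps (con c) ts' := by
  induction ts using List.reverseRecOn generalizing u with
  | nil => exact absurd h (not_step_con hR)
  | append_singleton ts t ih =>
    rw [apps_concat] at h
    rcases step_app_inv h with ⟨U, b, e, -⟩ | ⟨a, ha, rfl⟩ | ⟨b, hb, rfl⟩ | ⟨l, r, θ, hl, e, -⟩
    · have := congrArg spine e
      simp [spine_apps, spine] at this
    · obtain ⟨ts', hts, rfl⟩ := ih ha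
      exact ⟨ts' ++ [t], hts.append_right _, (apps_concat _ _ _).symm⟩
    · exact ⟨ts ++ [b], .append_left _ (.head _ hb), (apps_concat _ _ _).symm⟩
    · obtain ⟨f, ls, _, h'⟩ := hR.spine_lhs hl θ
      rw [e] at h'
      simp [spine_apps, spine] at h'

/-- A rule may consume only a prefix of the arguments; the list `us` is what remains to be applied
to the reduct. -/
theorem step_apps_fn (hR : FnRules R) {f : F} {ts : List (Term S C F)} {u : Term S C F}
    (h : Step R (apps (fn f) ts) u) :
    (∃ ts', ListStep R ts ts' ∧ u = apps (fn f) ts') ∨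
    ∃ ls r θ us, (apps (fn f) ls, r) ∈ R ∧ ts = ls.map (Term.subst θ) ++ us ∧
      u = apps (r.subst θ) us := by
  induction ts using List.reverseRecOn generalizing u with
  | nil =>
    obtain ⟨l, r, θ, hl, e, rfl⟩ := step_fn_inv h
    obtain ⟨g, ls, rfl, h'⟩ := hR.spine_lhs hl θ
    rw [e] at h'
    simp only [spine, Prod.mk.injEq, fn.injEq] at h'
    obtain ⟨rfl, h'⟩ := h'
    exact .inr ⟨ls, r, θ, [], hl, by simpa using h', rfl⟩
  | append_singleton ts t ih =>
    rw [apps_concat] at h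
    rcases step_app_inv h with ⟨U, b, e, -⟩ | ⟨a, ha, rfl⟩ | ⟨b, hb, rfl⟩ | ⟨l, r, θ, hl, e, rfl⟩
    · have := congrArg spine e
      simp [spine_apps, spine] at this
    · rcases ih ha with ⟨ts', hts, rfl⟩ | ⟨ls, r, θ, us, hl, rfl, rfl⟩
      · exact .inl ⟨ts' ++ [t], hts.append_right _, (apps_concat _ _ _).symm⟩
      · exact .inr ⟨ls, r, θ, us ++ [t], hl, by simp, (apps_concat _ _ _).symm⟩
    · exact .inl ⟨ts ++ [b], .append_left _ (.head _ hb), (apps_concat _ _ _).symm⟩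
    · obtain ⟨g, ls, rfl, h'⟩ := hR.spine_lhs hl θ
      rw [e, ← apps_concat, spine_apps] at h'
      simp only [spine, Prod.mk.injEq, fn.injEq, List.nil_append] at h'
      obtain ⟨rfl, h'⟩ := h'
      exact .inr ⟨ls, r, θ, [], hl, by simpa using h', rfl⟩

theorem apps_con_injective {c c' : C} {ts ts' : List (Term S C F)}
    (h : apps (con c) ts = apps (con c') ts') : c = c' ∧ ts = ts' := by
  have := congrArg spine h
  simpa [spine_apps, spine] using this

theorem apps_fn_injective {f g : F} {ts us : List (Term S C F)}
    (h : apps (fn f) ts = apps (fn g) us) : f = g ∧ ts = us := by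
  have := congrArg spine h
  simpa [spine_apps, spine] using this

theorem steps_apps_con (hR : FnRules R) {c : C} {ts : List (Term S C F)} {u : Term S C F}
    (h : Steps R (apps (con c) ts) u) :
    ∃ ts', u = apps (con c) ts' ∧ ts'.length = ts.length ∧
      ∀ k, Steps R (nth ts k) (nth ts' k) := by
  induction h with
  | refl => exact ⟨ts, rfl, rfl, fun _ => .refl⟩
  | tail _ hs ih =>
    obtain ⟨ts', rfl, hlen, hk⟩ := ih
    obtain ⟨us, hus, rfl⟩ := step_apps_con hR hs
    refine ⟨us, rfl, hus.length_eq.trans hlen, fun k => ?_⟩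
    rcases hus.nth k with e | e
    · rw [e]; exact hk k
    · exact (hk k).tail e

theorem sn_apps_con (hR : FnRules R) (c : C) {ts : List (Term S C F)}
    (h : ∀ k < ts.length, SN R (nth ts k)) : SN R (apps (con c) ts) := by
  induction acc_listStep ts h with
  | intro ts _ ih =>
    refine ⟨_, fun u hu => ?_⟩
    obtain ⟨ts', hts, rfl⟩ := step_apps_con hR hu
    refine ih ts' hts fun k hk => ?_
    rw [hts.length_eq] at hk
    rcases hts.nth k with e | e
    · rw [e]; exact h k hk
    · exact (h k hk).inv e

theorem sn_of_subst (θ : ℕ → Term S C F) {t : Term S C F} (h : SN R (t.subst θ)) : SN R t := by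
  generalize hs : t.subst θ = s at h
  induction h generalizing t with
  | intro s _ ih =>
    subst hs
    exact ⟨_, fun u hu => ih _ (Step.subst hu θ) rfl⟩

/-! ## Computability predicates -/

theorem Neutral.app {t : Term S C F} (h : Neutral R t) (u : Term S C F) :
    Neutral R (app t u) := by
  rcases h with ⟨x, vs, rfl⟩ | ⟨U, b, a, vs, rfl⟩ | ⟨f, ts, rfl, h⟩
  · exact .inl ⟨x, vs ++ [u], (apps_concat _ _ _).symm⟩
  · exact .inr (.inl ⟨U, b, a, vs ++ [u], (apps_concat _ _ _).symm⟩)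
  · refine .inr (.inr ⟨f, ts ++ [u], (apps_concat _ _ _).symm, fun ls r hl => ?_⟩)
    have := h ls r hl
    simp
    omega

/-- This is the point of neutrality: applying a neutral term creates no redex. It is not an
abstraction, and if it is headed by a function symbol it already has as many arguments as any rule
of that symbol, so no left-hand side matches with one argument more. -/
theorem Neutral.step_app_inv (hR : FnRules R) {t u v : Term S C F} (h : Neutral R t)
    (hs : Step R (Term.app t u) v) :
    (∃ t', Step R t t' ∧ v = Term.app t' u) ∨ ∃ u', Step R u u' ∧ v = Term.app t u' := by
  rcases SizeTermination.step_app_inv hs with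
    ⟨U, b, rfl, -⟩ | h' | h' | ⟨l, r, θ, hl, e, -⟩
  · rcases h with ⟨x, vs, e⟩ | ⟨U, b, a, vs, e⟩ | ⟨f, ts, e, -⟩ <;>
    · have := congrArg spine e
      simp [spine_apps, spine] at this
  · exact .inl h'
  · exact .inr h'
  · obtain ⟨g, ls, rfl, h'⟩ := hR.spine_lhs hl θ
    rw [e] at h'
    rcases h with ⟨x, vs, rfl⟩ | ⟨U, b, a, vs, rfl⟩ | ⟨f, ts, rfl, hf⟩
    · simp [spine_apps, spine] at h'
    · simp [spine_apps, spine] at h'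
    · simp only [spine_apps, spine, List.nil_append, Prod.mk.injEq, fn.injEq] at h'
      obtain ⟨rfl, h'⟩ := h'
      have h1 := congrArg List.length h'
      have h2 := hf ls r hl
      simp at h1
      omega

theorem not_neutral_apps_con (c : C) (ts : List (Term S C F)) :
    ¬ Neutral R (apps (con c) ts) := by
  rintro (⟨x, vs, e⟩ | ⟨U, b, a, vs, e⟩ | ⟨f, us, e, -⟩) <;>
  · have := congrArg spine e
    simp [spine_apps, spine] at this

theorem neutral_var (x : ℕ) : Neutral R (var x) := .inl ⟨x, [], rfl⟩

theorem IsCP.var_mem (hR : FnRules R) {P : Set (Term S C F)} (hP : IsCP R P) (x : ℕ) :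
    var x ∈ P := hP.2.2 _ (neutral_var x) fun _ h => absurd h (not_step_var hR)

theorem IsCP.steps {P : Set (Term S C F)} (hP : IsCP R P) {t u : Term S C F} (ht : t ∈ P)
    (h : Steps R t u) : u ∈ P := by
  induction h with
  | refl => exact ht
  | tail _ hs ih => exact hP.2.1 _ ih _ hs

theorem isCP_sn : IsCP R {t | SN R t} :=
  ⟨fun _ h => h, fun _ h _ hu => h.inv hu, fun _ _ h => ⟨_, h⟩⟩

/-- Strong normalization is read off from the application to a variable, which belongs to every
computability predicate. The neutral case is an induction on the strongly normalizing argument,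
since reducts of `app t u` come from `t` or from `u`. -/
theorem isCP_arrow (hR : FnRules R) {P Q : Set (Term S C F)} (hP : IsCP R P) (hQ : IsCP R Q) :
    IsCP R {t | ∀ u ∈ P, app t u ∈ Q} := by
  refine ⟨fun t ht => ?_, fun t ht u hu v hv => hQ.2.1 _ (ht v hv) _ (hu.appL v),
    fun t hn ht u hu => ?_⟩
  · have h := hQ.1 _ (ht _ (hP.var_mem hR 0))
    generalize hs : app t (var 0) = s at h
    clear ht
    induction h generalizing t with
    | intro s _ ih =>
      subst hs
      exact ⟨_, fun u hu => ih _ (Step.appL hu _) _ rfl⟩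
  · have h := hP.1 u hu
    induction h with
    | intro u _ ih =>
      refine hQ.2.2 _ (hn.app u) fun v hv => ?_
      rcases hn.step_app_inv hR hv with ⟨t', h', rfl⟩ | ⟨u', h', rfl⟩
      · exact ht _ h' u hu
      · exact ih u' h' (hP.2.1 _ hu _ h')

theorem isCP_interp (hR : FnRules R) {I : S → Set (Term S C F)} (hI : ∀ B, IsCP R (I B)) :
    ∀ T : Ty S, IsCP R (interp I T)
  | .base B => hI B
  | .arrow U V => isCP_arrow hR (isCP_interp hR hI U) (isCP_interp hR hI V)

/-- An intersection of computability predicates inherits their closure properties; it lies within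
the strongly normalizing terms because these form one of the predicates intersected. -/
theorem isCP_lub {Q : Set (Set (Term S C F))} (hQ : ∀ X ∈ Q, IsCP R X) : IsCP R (lub R Q) := by
  refine ⟨fun t ht => ht _ isCP_sn fun X hX => (hQ X hX).1, fun t ht u hu P hP hX =>
    hP.2.1 _ (ht P hP hX) _ hu, fun t hn ht P hP hX => hP.2.2 _ hn fun u hu => ht u hu P hP hX⟩

/-- A β-redex is neutral, so its reducts decide. Reducts inside the body or the argument are treated
by induction on their strong normalization, that of the body being inherited from its instance at a
variable. -/
theorem app_lam_mem (hR : FnRules R) {P Q : Set (Term S C F)} (hP : IsCP R P) (hQ : IsCP R Q)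
    (U : Ty S) {t : Term S C F} (h : ∀ u ∈ P, t.subst (inst u) ∈ Q) :
    ∀ u ∈ P, app (lam U t) u ∈ Q := by
  have ht : SN R t := sn_of_subst _ (hQ.1 _ (h _ (hP.var_mem hR 0)))
  induction ht with
  | intro t _ iht =>
    intro u hu
    induction hP.1 u hu with
    | intro u _ ihu =>
      refine hQ.2.2 _ (.inr (.inl ⟨U, t, u, [], rfl⟩)) fun v hv => ?_
      rcases step_app_inv hv with ⟨U, b, e, rfl⟩ | ⟨a, ha, rfl⟩ | ⟨b, hb, rfl⟩ |
        ⟨l, r, θ, hl, e, -⟩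
      · cases e
        exact h u hu
      · obtain ⟨t', ht', rfl⟩ := step_lam_inv hR ha
        exact iht t' ht' (fun w hw => hQ.2.1 _ (h w hw) _ (Step.subst ht' _)) u hu
      · exact ihu b hb (hP.2.1 _ hu _ hb)
      · obtain ⟨f, ls, _, h'⟩ := hR.spine_lhs hl θ
        rw [e] at h'
        simp [spine] at h'

end Steps
/-! ## Positivity -/

section Positivity
variable {S C F : Type}

theorem override_self (I : S → Set (Term S C F)) (B : S) : override I B (I B) = I :=
  Function.update_eq_self B I

theorem override_same (I : S → Set (Term S C F)) (B : S) (X : Set (Term S C F)) :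
    override I B X B = X := Function.update_self _ _ _

theorem override_of_ne (I : S → Set (Term S C F)) {B D : S} (X : Set (Term S C F)) (h : D ≠ B) :
    override I B X D = I D := Function.update_of_ne h _ _

/-- Both polarities must be proved together, because the left of an arrow exchanges them. -/
theorem interp_override_mono_antitone (I : S → Set (Term S C F)) (B : S) {X Y : Set (Term S C F)}
    (h : X ⊆ Y) (T : Ty S) :
    (T.occ B ⊆ T.pos true → interp (override I B X) T ⊆ interp (override I B Y) T) ∧
    (T.occ B ⊆ T.pos false → interp (override I B Y) T ⊆ interp (override I B X) T) := by
  induction T with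
  | base D =>
    by_cases hD : D = B
    · subst hD
      simp only [interp, override_same]
      refine ⟨fun _ => h, fun h' => ?_⟩
      have := h' (show [] ∈ (Ty.base D).occ D from ⟨rfl, rfl⟩)
      simp [Ty.pos] at this
    · simp only [interp, override_of_ne _ _ hD]
      exact ⟨fun _ => subset_rfl, fun _ => subset_rfl⟩
  | arrow U V ihU ihV =>
    have key : ∀ s, (Ty.arrow U V).occ B ⊆ (Ty.arrow U V).pos s →
        U.occ B ⊆ U.pos (!s) ∧ V.occ B ⊆ V.pos s := by
      intro s hs
      refine ⟨fun p hp => ?_, fun p hp => ?_⟩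
      · obtain ⟨p', ⟨e, h⟩ | ⟨e, h⟩⟩ := hs (show 1 :: p ∈ _ from ⟨p, .inl ⟨rfl, hp⟩⟩)
        · cases e; exact h
        · cases e
      · obtain ⟨p', ⟨e, h⟩ | ⟨e, h⟩⟩ := hs (show 2 :: p ∈ _ from ⟨p, .inr ⟨rfl, hp⟩⟩)
        · cases e
        · cases e; exact h
    refine ⟨fun hs t ht u hu => ?_, fun hs t ht u hu => ?_⟩
    · exact ihV.1 (key _ hs).2 (ht u (ihU.2 (key _ hs).1 hu))
    · exact ihV.2 (key _ hs).2 (ht u (ihU.1 (key _ hs).1 hu))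

theorem interp_override_mono (I : S → Set (Term S C F)) {B : S} {X Y : Set (Term S C F)}
    (h : X ⊆ Y) {T : Ty S} (hT : T.OnlyPos B) :
    interp (override I B X) T ⊆ interp (override I B Y) T :=
  (interp_override_mono_antitone I B h T).1 hT

theorem interp_congr {I J : S → Set (Term S C F)} {T : Ty S}
    (h : ∀ D, T.occ D ≠ ∅ → I D = J D) : interp I T = interp J T := by
  induction T with
  | base D =>
    exact h D (Set.nonempty_iff_ne_empty.1 ⟨[], rfl, rfl⟩)
  | arrow U V ihU ihV =>
    have hU : interp I U = interp J U := ihU fun D hD => h D <| by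
      obtain ⟨p, hp⟩ := Set.nonempty_iff_ne_empty.2 hD
      exact Set.nonempty_iff_ne_empty.1 ⟨1 :: p, p, .inl ⟨rfl, hp⟩⟩
    have hV : interp I V = interp J V := ihV fun D hD => h D <| by
      obtain ⟨p, hp⟩ := Set.nonempty_iff_ne_empty.2 hD
      exact Set.nonempty_iff_ne_empty.1 ⟨2 :: p, p, .inr ⟨rfl, hp⟩⟩
    simp only [interp, hU, hV]

theorem interp_override_of_occ_eq_empty (I : S → Set (Term S C F)) {B : S} (X : Set (Term S C F))
    {T : Ty S} (h : T.occ B = ∅) : interp (override I B X) T = interp I T :=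
  interp_congr fun _ hD => override_of_ne _ _ fun e => hD (e ▸ h)

/-- The Knaster–Tarski argument. -/
theorem leastFix_eq {Φ : Set (Term S C F) → Set (Term S C F)} (h : ∀ X Y, X ⊆ Y → Φ X ⊆ Φ Y) :
    Φ (leastFix Φ) = leastFix Φ := by
  have h1 : Φ (leastFix Φ) ⊆ leastFix Φ :=
    Set.subset_sInter fun X hX => (h _ _ (Set.sInter_subset_of_mem hX)).trans hX
  exact h1.antisymm (Set.sInter_subset_of_mem (h _ _ h1))

end Positivity

/-! ## Interpretation of sorts -/

section SortInterp
variable {S C F : Type} {Sg : Sig S C F} {R : Set (Term S C F × Term S C F)}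

/-- Membership conditions on the maximally applied constructors to which a term reduces define a
computability predicate. -/
theorem isCP_of_reducesToCon (B : S) (Q : C → List (Term S C F) → Prop) :
    IsCP R {t | SN R t ∧ ∀ c ts, ReducesToCon Sg R B t c ts → Q c ts} := by
  refine ⟨fun t ht => ht.1, fun t ht u hu => ⟨ht.1.inv hu, fun c ts h => ht.2 c ts
    ⟨h.1, h.2.1, h.2.2.head hu⟩⟩, fun t hn ht => ⟨⟨_, fun u hu => (ht u hu).1⟩,
    fun c ts h => ?_⟩⟩
  rcases Relation.ReflTransGen.cases_head h.2.2 with e | ⟨u, hu, hs⟩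
  · exact absurd (e ▸ hn) (not_neutral_apps_con c ts)
  · exact (ht u hu).2 c ts ⟨h.1, h.2.1, hs⟩

variable [PartialOrder S] {AA : AccArgs Sg}

theorem sortOp_mono (B : S) (I : S → Set (Term S C F)) {X Y : Set (Term S C F)} (h : X ⊆ Y) :
    sortOp R AA B I X ⊆ sortOp R AA B I Y := fun _ ht => ⟨ht.1, fun c ts hc k hk =>
  interp_override_mono I h (hc.1 ▸ (AA.accessible c k hk).2) (ht.2 c ts hc k hk)⟩

/-- Accessible arguments mention only sorts below or equal to `B`, so the default value used for the
other sorts in the recursive definition is harmless. -/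
theorem sortOp_congr {B : S} {I J : S → Set (Term S C F)} (h : ∀ D < B, I D = J D)
    (X : Set (Term S C F)) : sortOp R AA B I X = sortOp R AA B J X := by
  have key : ∀ c k, (Sg.tyC c).resSort = B → k < AA.q c →
      interp (override I B X) ((Sg.tyC c).argTy k) =
        interp (override J B X) ((Sg.tyC c).argTy k) := by
    intro c k hc hk
    refine interp_congr fun D hD => ?_
    by_cases e : D = B
    · subst e; rw [override_same, override_same]
    · rw [override_of_ne _ _ e, override_of_ne _ _ e]
      exact h D (lt_of_le_of_ne (hc ▸ ((AA.accessible c k hk).1 D).resolve_left hD) e)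
  ext t
  refine and_congr_right fun _ => forall_congr' fun c => forall_congr' fun ts =>
    forall_congr' fun hc => forall_congr' fun k => forall_congr' fun hk => ?_
  rw [key c k hc.1 hk]

variable [WellFoundedLT S]

theorem sortInterp_eq_leastFix (B : S) :
    sortInterp R AA B = leastFix (sortOp R AA B (sortInterp R AA)) := by
  rw [sortInterp_eq]
  congr 1
  funext X
  exact sortOp_congr (fun D hD => if_pos hD) X

theorem mem_sortInterp {B : S} {t : Term S C F} :
    t ∈ sortInterp R AA B ↔ SN R t ∧ ∀ c ts, ReducesToCon Sg R B t c ts →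
      ∀ k < AA.q c, nth ts k ∈ interp (sortInterp R AA) ((Sg.tyC c).argTy k) := by
  have h := leastFix_eq (fun X Y => sortOp_mono (R := R) (AA := AA) B (sortInterp R AA))
  rw [← sortInterp_eq_leastFix] at h
  conv_lhs => rw [← h]
  simp only [sortOp, override_self, Set.mem_ofPred_eq]

theorem isCP_sortInterp (B : S) : IsCP R (sortInterp R AA B) := by
  have : sortInterp R AA B = {t | SN R t ∧ ∀ c ts, ReducesToCon Sg R B t c ts →
      ∀ k < AA.q c, nth ts k ∈ interp (sortInterp R AA) ((Sg.tyC c).argTy k)} :=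
    Set.ext fun t => mem_sortInterp
  rw [this]
  exact isCP_of_reducesToCon B _

end SortInterp

/-! ## Ordinals -/

section Ordinals
variable {S C F : Type}

theorem infinite_term : Infinite (Term S C F) :=
  Infinite.of_injective (var : ℕ → Term S C F) fun _ _ h => by cases h; rfl

theorem aleph0_le_mk_set_term : Cardinal.aleph0 ≤ Cardinal.mk (Set (Term S C F)) :=
  haveI : Infinite (Term S C F) := infinite_term
  Cardinal.aleph0_le_mk _

/-- The successor of an ordinal smaller than `kh`. -/
noncomputable def khSucc (κ : Kh S C F) : Kh S C F :=
  ⟨Order.succ κ.1, (Cardinal.isSuccLimit_ord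
    (aleph0_le_mk_set_term.trans (Order.le_succ _))).succ_lt κ.2⟩

theorem khSucc_not_limit (κ : Kh S C F) : ¬ Order.IsSuccLimit (khSucc κ).1 :=
  Order.not_isSuccLimit_succ κ.1

theorem lt_khSucc (κ : Kh S C F) : κ < khSucc κ := Order.lt_succ κ.1

theorem le_of_lt_succ {κ lam β : Kh S C F} (h : κ < lam) (e : lam.1 = Order.succ β.1) : κ ≤ β :=
  (Order.lt_succ_iff (a := κ.1) (b := β.1)).1 (e ▸ h : κ.1 < Order.succ β.1)

theorem exists_eq_succ {κ lam : Kh S C F} (h : ¬ Order.IsSuccLimit κ.1) (hlt : lam < κ) :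
    ∃ β : Kh S C F, κ.1 = Order.succ β.1 := by
  rcases Ordinal.zero_or_succ_or_isSuccLimit κ.1 with h0 | ⟨b, hb⟩ | hl
  · exact absurd (show lam.1 < κ.1 from hlt) (by simp [h0])
  · exact ⟨⟨b, (Order.lt_succ b).trans (hb ▸ κ.2)⟩, hb.symm⟩
  · exact absurd hl h

/-- A family of ordinals smaller than `kh` that is indexed by terms is bounded. -/
theorem exists_forall_le {ι : Type} (g : ι → Term S C F) (hg : Function.Injective g)
    (f : ι → Kh S C F) : ∃ κ, ∀ i, f i ≤ κ := by
  have hcard : Cardinal.mk ι < (kh S C F).cof := by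
    -- A successor cardinal is regular, so the cofinality of `kh` exceeds the number of sets of
    -- terms, hence the number of terms.
    rw [kh, (Cardinal.isRegular_succ aleph0_le_mk_set_term).cof_ord]
    refine ((Cardinal.mk_le_of_injective hg).trans_lt ?_).trans (Order.lt_succ _)
    rw [Cardinal.mk_set]
    exact Cardinal.cantor _
  exact ⟨⟨⨆ i, (f i).1, Ordinal.iSup_lt_of_lt_cof hcard fun i => (f i).2⟩,
    fun i => Ordinal.le_iSup (fun i => (f i).1) i⟩

theorem osize_mem {fam : Kh S C F → Set (Term S C F)} {t : Term S C F} (h : ∃ κ, t ∈ fam κ) :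
    t ∈ fam (osize fam t) := by
  rw [osize, dif_pos h]
  exact WellFounded.min_mem wellFounded_lt {κ | t ∈ fam κ} h

theorem osize_le {fam : Kh S C F → Set (Term S C F)} {t : Term S C F} {κ : Kh S C F}
    (h : t ∈ fam κ) : osize fam t ≤ κ := by
  rw [osize, dif_pos ⟨κ, h⟩]
  exact not_lt.1 (WellFounded.not_lt_min wellFounded_lt {κ | t ∈ fam κ} h)

end Ordinals

/-! ## Stratifications -/

section Strat
variable {S C F : Type} {SV SF : Type*} [PartialOrder S]
  {Sg : Sig S C F} {Al : SizeAlg S C F SV SF} {R : Set (Term S C F × Term S C F)}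
  {CA : ConAnnot Sg Al}

theorem ConAnnot.sizeFun_congr (c : C) {o o' : ℕ → Kh S C F}
    (h : ∀ k < CA.q c, CA.α c k ≠ none → o k = o' k) : CA.sizeFun c o = CA.sizeFun c o' := by
  have : CA.valuation c o = CA.valuation c o' := by
    funext v
    refine Finset.sup_congr rfl fun k hk => ?_
    simp only [Finset.mem_filter, Finset.mem_range] at hk
    exact h k hk.1 (by simp [hk.2])
  simp only [ConAnnot.sizeFun, this]

/-- The measured sort occurs in an argument where the result sort does not, so the two differ. -/
theorem ConAnnot.srt_lt {c : C} {k : ℕ} (hp : CA.p c ≤ k) (hq : k < CA.q c)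
    (hα : CA.α c k ≠ none) : CA.srt c k < (Sg.tyC c).resSort := by
  have h := CA.srt_occ c k hp hq hα
  refine lt_of_le_of_ne (((CA.accessible c k hq).1 _).resolve_left h) fun e => h ?_
  rw [e]
  exact CA.nonrecursive c k hp hq

theorem ConAnnot.onlyPos_argTy {B : S} {c : C} (hc : (Sg.tyC c).resSort = B) {k : ℕ}
    (hk : k < CA.q c) : ((Sg.tyC c).argTy k).OnlyPos B := hc ▸ (CA.accessible c k hk).2

theorem ConAnnot.onlyPos_srt {c : C} {k : ℕ} (hk : k < CA.q c) (hα : CA.α c k ≠ none) :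
    ((Sg.tyC c).argTy k).OnlyPos (CA.srt c k) := by
  by_cases hp : k < CA.p c
  · rw [CA.srt_rec c k hp]
    exact CA.onlyPos_argTy rfl hk
  · exact CA.srt_pos c k (not_lt.1 hp) hk hα

variable [WellFoundedLT S]

theorem strat_of_isSuccLimit {B : S} {κ : Kh S C F} (h : Order.IsSuccLimit κ.1) :
    strat R CA B κ = lub R {X | ∃ β < κ, X = strat R CA B β} := by
  rw [strat_eq, stratStep, if_pos h]
  simp only [exists_prop]

theorem isCP_strat (B : S) (κ : Kh S C F) : IsCP R (strat R CA B κ) := by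
  induction κ using WellFoundedLT.induction with
  | ind κ ih =>
    by_cases h : Order.IsSuccLimit κ.1
    · rw [strat_of_isSuccLimit h]
      refine isCP_lub ?_
      rintro _ ⟨β, hβ, rfl⟩
      exact ih β hβ
    · rw [strat_eq, stratStep, if_neg h]
      exact isCP_of_reducesToCon B _

variable (R CA) in
/-- The sizes of the arguments of a constructor. -/
noncomputable def conSize (c : C) (ts : List (Term S C F)) (k : ℕ) : Kh S C F :=
  sizeIn R CA (CA.srt c k) ((Sg.tyC c).argTy k) (nth ts k)

/-- Replaces the sizes that `stratStep` computes from the stages already built by the true sizes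
`conSize`. Truncating the search at `κ` loses nothing, since a recursive argument already lies in
the predecessor stage. -/
theorem mem_strat {B : S} {κ : Kh S C F} (h : ¬ Order.IsSuccLimit κ.1) {t : Term S C F} :
    t ∈ strat R CA B κ ↔ SN R t ∧ ∀ c ts, ReducesToCon Sg R B t c ts →
      (∀ k < CA.p c, ∃ β : Kh S C F, κ.1 = Order.succ β.1 ∧
        nth ts k ∈ interp (override (sortInterp R CA.toAccArgs) B (strat R CA B β))
          ((Sg.tyC c).argTy k)) ∧
      (∀ k, CA.p c ≤ k → k < CA.q c →
        nth ts k ∈ interp (sortInterp R CA.toAccArgs) ((Sg.tyC c).argTy k)) ∧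
      CA.sizeFun c (conSize R CA c ts) ≤ κ := by
  rw [strat_eq, stratStep, if_neg h, Set.mem_ofPred_eq]
  refine and_congr_right fun _ => forall_congr' fun c => forall_congr' fun ts =>
    forall_congr' fun hc => ?_
  have hlt : ∀ β : Kh S C F, κ.1 = Order.succ β.1 → β < κ := fun β e =>
    show β.1 < κ.1 from e ▸ Order.lt_succ _
  have h1 : (∀ k < CA.p c, ∃ (β : Kh S C F) (_ : β < κ), κ.1 = Order.succ β.1 ∧
      nth ts k ∈ interp (override (sortInterp R CA.toAccArgs) B (strat R CA B β))
        ((Sg.tyC c).argTy k)) ↔ ∀ k < CA.p c, ∃ β : Kh S C F, κ.1 = Order.succ β.1 ∧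
      nth ts k ∈ interp (override (sortInterp R CA.toAccArgs) B (strat R CA B β))
        ((Sg.tyC c).argTy k) :=
    forall_congr' fun k => forall_congr' fun hk => exists_congr fun β =>
      ⟨fun ⟨_, h⟩ => h, fun h => ⟨hlt β h.1, h⟩⟩
  rw [h1]
  refine and_congr_right fun hrec => and_congr_right fun _ => ?_
  rw [CA.sizeFun_congr c fun k hk hα => ?_]
  obtain ⟨rfl, -⟩ := hc
  by_cases hp : k < CA.p c
  · rw [if_pos hp, conSize, sizeIn, CA.srt_rec c k hp]
    obtain ⟨β, hβ, hm⟩ := hrec k hp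
    refine le_antisymm (osize_le ⟨?_, ?_⟩) (osize_le ?_)
    · exact lt_of_le_of_lt (osize_le hm) (hlt β hβ)
    · exact osize_mem (fam := fun β => interp (override (sortInterp R CA.toAccArgs)
        (Sg.tyC c).resSort (strat R CA (Sg.tyC c).resSort β)) ((Sg.tyC c).argTy k)) ⟨β, hm⟩
    · exact (osize_mem (fam := fun β => {u | ∃ _ : β < κ, u ∈ interp
        (override (sortInterp R CA.toAccArgs) (Sg.tyC c).resSort
          (strat R CA (Sg.tyC c).resSort β)) ((Sg.tyC c).argTy k)}) ⟨β, hlt β hβ, hm⟩).2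
  -- A measured nonrecursive argument has a strictly smaller sort, whose stratification is complete;
  -- the default `⊥` concerns only arguments annotated with `∞`.
  · rw [if_neg hp, dif_pos (CA.srt_lt (not_lt.1 hp) hk hα)]
    rfl

theorem strat_subset_sortInterp (B : S) (κ : Kh S C F) :
    strat R CA B κ ⊆ sortInterp R CA.toAccArgs B := by
  induction κ using WellFoundedLT.induction with
  | ind κ ih =>
    by_cases h : Order.IsSuccLimit κ.1
    · rw [strat_of_isSuccLimit h]
      intro t ht
      refine ht _ (isCP_sortInterp B) ?_
      rintro _ ⟨β, hβ, rfl⟩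
      exact ih β hβ
    · intro t ht
      rw [mem_strat h] at ht
      refine mem_sortInterp.2 ⟨ht.1, fun c ts hc k hk => ?_⟩
      obtain ⟨hrec, hnrec, -⟩ := ht.2 c ts hc
      by_cases hp : k < CA.p c
      · obtain ⟨β, hβ, hm⟩ := hrec k hp
        have := interp_override_mono (sortInterp R CA.toAccArgs)
          (ih β (show β.1 < κ.1 from hβ ▸ Order.lt_succ _)) (CA.onlyPos_argTy hc.1 hk) hm
        rwa [override_self] at this
      · exact hnrec k (not_lt.1 hp) hk

/-- Induction on the larger index, then on the smaller one. Limits are handled by the universal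
property of `lub`; between non-limit stages, the recursive arguments move from the predecessor of
the smaller index to that of the larger one. -/
theorem strat_mono (B : S) : Monotone (strat R CA B) := by
  intro κ lam hle
  induction lam using WellFoundedLT.induction generalizing κ with
  | ind lam ih =>
    rcases hle.eq_or_lt with rfl | hlt
    · exact le_rfl
    by_cases hl : Order.IsSuccLimit lam.1
    · rw [strat_of_isSuccLimit hl]
      exact fun t ht P _ hP => hP _ ⟨κ, hlt, rfl⟩ ht
    · clear hle
      induction κ using WellFoundedLT.induction with
      | ind κ ihκ =>
        by_cases hκ : Order.IsSuccLimit κ.1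
        · rw [strat_of_isSuccLimit hκ]
          intro t ht
          refine ht _ (isCP_strat B lam) ?_
          rintro _ ⟨β, hβ, rfl⟩
          exact ihκ β hβ (hβ.trans hlt)
        · intro t ht
          rw [mem_strat hκ] at ht
          refine (mem_strat hl).2 ⟨ht.1, fun c ts hc => ?_⟩
          obtain ⟨hrec, hnrec, hs⟩ := ht.2 c ts hc
          refine ⟨fun k hk => ?_, hnrec, hs.trans hlt.le⟩
          obtain ⟨γ, hγ, hm⟩ := hrec k hk
          obtain ⟨β, hβ⟩ := exists_eq_succ hl hlt
          have hγκ : γ < κ := show γ.1 < κ.1 from hγ ▸ Order.lt_succ _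
          exact ⟨β, hβ, interp_override_mono _ (ih β (show β.1 < lam.1 from hβ ▸ Order.lt_succ _)
            (hγκ.le.trans (le_of_lt_succ hlt hβ)))
            (CA.onlyPos_argTy hc.1 (hk.trans_le (CA.p_le c))) hm⟩

/-- The stages stabilize below `kh`, and the stable stage is a pre-fixpoint of the operator defining
the sort, hence contains the sort. -/
theorem exists_strat_eq_sortInterp (B : S) :
    ∃ κ, strat R CA B κ = sortInterp R CA.toAccArgs B := by
  obtain ⟨κ, hκ⟩ := exists_forall_le id Function.injective_id fun t => osize (strat R CA B) t
  have hκ' : ∀ lam, strat R CA B lam ⊆ strat R CA B κ := fun lam t ht =>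
    strat_mono B (hκ t) (osize_mem ⟨lam, ht⟩)
  -- Besides the stage `κ` that contains all the others, a bound on all the values of size functions
  -- is needed. Pairs of a constructor and a list of arguments are as few as terms, which they
  -- inject into.
  obtain ⟨lam, hlam⟩ := exists_forall_le (fun p : C × List (Term S C F) => apps (con p.1) p.2)
    (fun p p' h => Prod.ext_iff.2 (apps_con_injective h))
    fun p => CA.sizeFun p.1 (conSize R CA p.1 p.2)
  refine ⟨κ, (strat_subset_sortInterp B κ).antisymm ?_⟩
  rw [sortInterp_eq_leastFix]
  -- A successor stage whose predecessor is above `κ` accepts the recursive arguments, and one above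
  -- `lam` meets the size condition; by the choice of `κ` it is still included in stage `κ`.
  refine Set.sInter_subset_of_mem fun t ht => hκ' (khSucc (max κ lam)) ?_
  refine (mem_strat (khSucc_not_limit _)).2 ⟨ht.1, fun c ts hc => ⟨fun k hk => ?_,
    fun k hp hk => ?_, ?_⟩⟩
  · have hq := hk.trans_le (CA.p_le c)
    exact ⟨max κ lam, rfl, interp_override_mono _ (strat_mono B (le_max_left _ _))
      (CA.onlyPos_argTy hc.1 hq) (ht.2 c ts hc k hq)⟩
  · have := ht.2 c ts hc k hk
    rwa [interp_override_of_occ_eq_empty _ _ (hc.1 ▸ CA.nonrecursive c k hp hk)] at this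
  · exact (hlam (c, ts)).trans ((le_max_right _ _).trans (lt_khSucc _).le)

theorem mem_interp_sizeIn {D : S} {T : Ty S} {t : Term S C F}
    (ht : t ∈ interp (sortInterp R CA.toAccArgs) T) :
    t ∈ interp (override (sortInterp R CA.toAccArgs) D (strat R CA D (sizeIn R CA D T t))) T := by
  obtain ⟨κ, hκ⟩ := exists_strat_eq_sortInterp (R := R) (CA := CA) D
  refine osize_mem (fam := fun κ => interp (override (sortInterp R CA.toAccArgs) D
    (strat R CA D κ)) T) ⟨κ, ?_⟩
  rwa [hκ, override_self]

theorem mem_strat_osize {D : S} {t : Term S C F} (ht : t ∈ sortInterp R CA.toAccArgs D) :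
    t ∈ strat R CA D (osize (strat R CA D) t) := by
  obtain ⟨κ, hκ⟩ := exists_strat_eq_sortInterp (R := R) (CA := CA) D
  exact osize_mem ⟨κ, hκ ▸ ht⟩

theorem interp_override_strat_subset (D : S) (κ : Kh S C F) {T : Ty S} (hT : T.OnlyPos D) :
    interp (override (sortInterp R CA.toAccArgs) D (strat R CA D κ)) T ⊆
      interp (sortInterp R CA.toAccArgs) T := by
  have := interp_override_mono (sortInterp R CA.toAccArgs) (strat_subset_sortInterp (R := R) (CA := CA) D κ) hT
  rwa [override_self] at this

/-- Accessible subterms of computable terms are computable. -/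
theorem Accessible.mem_interp {u t : Term S C F} {U T : Ty S} {D B : S}
    (h : Accessible CA u U D t T B) (θ : ℕ → Term S C F)
    (ht : t.subst θ ∈ interp (sortInterp R CA.toAccArgs) T) :
    u.subst θ ∈ interp (sortInterp R CA.toAccArgs) U := by
  induction h with
  | refl => exact ht
  | @step c ts B k hc hlen hk _ ih =>
    refine ih ?_
    rw [subst_apps] at ht
    have := (mem_sortInterp.1 ht).2 c _ ⟨hc, (List.length_map _).trans hlen, .refl⟩ k hk
    have hk' : k < ts.length := hlen ▸ hk.trans_le (CA.q_le c)
    rw [nth_lt (by simpa using hk')] at this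
    rw [nth_lt hk']
    simpa using this

end Strat
/-! ## Size expressions -/

section SizeExpressions
variable {S C F : Type} {SV SF : Type*} {Al : SizeAlg S C F SV SF}

/-- Monotonicity is known one argument at a time, so the coordinates of `x` are exchanged for those
of `y` one by one. -/
theorem SizeAlg.J_le_J {g : SF} {x y : Fin (Al.ar g) → Kh S C F}
    (h : ∀ i, (i ∈ Al.MonPos g ∧ x i ≤ y i) ∨ (i ∈ Al.MonNeg g ∧ y i ≤ x i) ∨ x i = y i) :
    Al.J g x ≤ Al.J g y := by
  have key : ∀ s : Finset (Fin (Al.ar g)), Al.J g x ≤ Al.J g (s.piecewise y x) := by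
    intro s
    induction s using Finset.induction with
    | empty => simp
    | insert j s hj ih =>
      refine ih.trans ?_
      have e : s.piecewise y x = Function.update (s.piecewise y x) j (x j) := by
        rw [← s.piecewise_eq_of_notMem y x hj, Function.update_eq_self]
      rw [Finset.piecewise_insert]
      conv_lhs => rw [e]
      rcases h j with ⟨hm, hl⟩ | ⟨hm, hl⟩ | hl
      · exact hm.2 _ _ _ hl
      · exact hm.2 _ _ _ hl
      · rw [hl]
  simpa using key Finset.univ

theorem SizeAlg.eval_mono_antitone {μ μ' : SV → Kh S C F} (e : Al.E)
    (h : ∀ v ∈ e.vars, μ v ≤ μ' v) :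
    ((∀ v ∈ e.vars, e.occ v ⊆ Al.pos true e) → e.eval Al.J μ ≤ e.eval Al.J μ') ∧
    ((∀ v ∈ e.vars, e.occ v ⊆ Al.pos false e) → e.eval Al.J μ' ≤ e.eval Al.J μ) := by
  induction e with
  | var w =>
    refine ⟨fun _ => h w rfl, fun h' => ?_⟩
    have := h' w rfl (show [] ∈ (SExp.var w).occ w from ⟨rfl, rfl⟩)
    simp [SizeAlg.pos] at this
  | app g b ih =>
    have hb : ∀ i, ∀ v ∈ (b i).vars, μ v ≤ μ' v := fun i v hv => h v ⟨i, hv⟩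
    have occ_app : ∀ s, (∀ v ∈ (SExp.app g b).vars, (SExp.app g b).occ v ⊆
        Al.pos s (SExp.app g b)) → ∀ i, ∀ v ∈ (b i).vars, ∀ p ∈ (b i).occ v,
        (i ∈ Al.MonPos g ∧ p ∈ Al.pos s (b i)) ∨ (i ∈ Al.MonNeg g ∧ p ∈ Al.pos (!s) (b i)) := by
      intro s hs i v hv p hp
      rcases hs v ⟨i, hv⟩ (show (i.val + 1) :: p ∈ _ from ⟨i, p, rfl, hp⟩) with
        ⟨-, h, -⟩ | ⟨j, p', e, h⟩
      · cases h
      · simp only [List.cons.injEq, add_left_inj, Fin.val_inj] at e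
        obtain ⟨rfl, rfl⟩ := e
        exact h
    constructor <;> intro hs <;> refine Al.J_le_J fun i => ?_ <;>
      have hi := occ_app _ hs i <;> have ihi := ih i (hb i)
    · by_cases hp : i ∈ Al.MonPos g <;> by_cases hn : i ∈ Al.MonNeg g
      -- An argument both monotone and anti-monotone accepts a change in either direction, so
      -- totality of the order on ordinals suffices.
      · rcases le_total ((b i).eval Al.J μ) ((b i).eval Al.J μ') with hl | hl
        · exact .inl ⟨hp, hl⟩
        · exact .inr (.inl ⟨hn, hl⟩)
      · exact .inl ⟨hp, ihi.1 fun v hv p hq => ((hi v hv p hq).resolve_right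
          fun h => hn h.1).2⟩
      · exact .inr (.inl ⟨hn, ihi.2 fun v hv p hq => ((hi v hv p hq).resolve_left
          fun h => hp h.1).2⟩)
      -- An argument that admits no label contains no variable occurrence, so both inductive
      -- inequalities hold vacuously and its value does not change.
      · have hi' : ∀ v ∈ (b i).vars, ∀ p ∈ (b i).occ v, False := fun v hv p hq =>
          (hi v hv p hq).elim (fun h => hp h.1) fun h => hn h.1
        exact .inr (.inr (le_antisymm (ihi.1 fun v hv p hq => (hi' v hv p hq).elim)
          (ihi.2 fun v hv p hq => (hi' v hv p hq).elim)))
    · by_cases hp : i ∈ Al.MonPos g <;> by_cases hn : i ∈ Al.MonNeg g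
      · rcases le_total ((b i).eval Al.J μ) ((b i).eval Al.J μ') with hl | hl
        · exact .inr (.inl ⟨hn, hl⟩)
        · exact .inl ⟨hp, hl⟩
      · exact .inl ⟨hp, ihi.2 fun v hv p hq => ((hi v hv p hq).resolve_right
          fun h => hn h.1).2⟩
      · exact .inr (.inl ⟨hn, ihi.1 fun v hv p hq => ((hi v hv p hq).resolve_left
          fun h => hp h.1).2⟩)
      · have hi' : ∀ v ∈ (b i).vars, ∀ p ∈ (b i).occ v, False := fun v hv p hq =>
          (hi v hv p hq).elim (fun h => hp h.1) fun h => hn h.1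
        exact .inr (.inr (le_antisymm (ihi.2 fun v hv p hq => (hi' v hv p hq).elim)
          (ihi.1 fun v hv p hq => (hi' v hv p hq).elim)))

theorem SizeAlg.eval_mono {μ μ' : SV → Kh S C F} {e : Al.E} (h : ∀ v ∈ e.vars, μ v ≤ μ' v)
    (hp : ∀ v ∈ e.vars, Al.OnlyPos v (some e)) : e.eval Al.J μ ≤ e.eval Al.J μ' :=
  (Al.eval_mono_antitone e h).1 fun v hv => hp v hv e rfl

/-- A finite result means that no variable of `e` is sent to `∞`, so the default `d` is arbitrary.
Callers choose for it the actual sizes of arguments. -/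
theorem SExp.eval_of_substTop_eq_some {ar : SF → ℕ} {K : Type*} (J : ∀ g, (Fin (ar g) → K) → K)
    (ν d : SV → K) (ψ : SV → Option (SExp SV SF ar)) {e e' : SExp SV SF ar}
    (h : e.substTop ψ = some e') :
    e'.eval J ν = e.eval J fun v => (ψ v).elim (d v) (eval J ν) := by
  induction e generalizing e' with
  | var v =>
    rw [substTop] at h
    simp [eval, h]
  | app g b ih =>
    rw [substTop] at h
    split_ifs at h with hb
    cases h
    simp only [eval]
    congr 1
    funext i
    exact ih i (Option.some_get (hb i)).symm

theorem SExp.isSome_substTop {ar : SF → ℕ} (φ : SV → SExp SV SF ar) (e : SExp SV SF ar) :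
    (e.substTop fun v => some (φ v)).isSome := by
  induction e with
  | var v => rfl
  | app g b ih => rw [substTop, dif_pos ih]; rfl

end SizeExpressions

/-! ## Interpretation of annotated types -/

section Annotated
variable {S : Type} {SV SF : Type*} {ar : SF → ℕ} {E : Type*}

theorem annot_subst (ψ : SV → Option (SExp SV SF ar)) (B : S) (a : Option (SExp SV SF ar))
    (T : Ty S) : (T.annot B a).subst ψ = T.annot B (a.bind (SExp.substTop ψ)) := by
  induction T with
  | base D =>
    simp only [Ty.annot, ATy.subst]
    split_ifs <;> rfl
  | arrow U V ihU ihV => simp only [Ty.annot, ATy.subst, ihU, ihV]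

theorem embed_subst (ψ : SV → Option (SExp SV SF ar)) (T : Ty S) :
    (T.embed : ATy S (SExp SV SF ar)).subst ψ = T.embed := by
  induction T with
  | base D => rfl
  | arrow U V ihU ihV => simp only [Ty.embed, ATy.subst, ihU, ihV]

theorem annot_none (B : S) (T : Ty S) : (T.annot B none : ATy S E) = T.embed := by
  induction T with
  | base D => simp [Ty.annot, Ty.embed]
  | arrow U V ihU ihV => simp only [Ty.annot, Ty.embed, ihU, ihV]

theorem erase_embed (T : Ty S) : (T.embed : ATy S E).erase = T := by
  induction T with
  | base D => rfl
  | arrow U V ihU ihV => simp only [Ty.embed, ATy.erase, ihU, ihV]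

theorem erase_annot (B : S) (a : Option E) (T : Ty S) : (T.annot B a).erase = T := by
  induction T with
  | base D => rfl
  | arrow U V ihU ihV => simp only [Ty.annot, ATy.erase, ihU, ihV]

theorem annotWith_subst (ψ : SV → Option (SExp SV SF ar)) (σ : Option (SExp SV SF ar))
    (args : ℕ → ATy S (SExp SV SF ar)) (T : Ty S) :
    (T.annotWith σ args).subst ψ =
      T.annotWith (σ.bind (SExp.substTop ψ)) fun i => (args i).subst ψ := by
  induction T generalizing args with
  | base D => rfl
  | arrow U V _ ih => simp only [Ty.annotWith, ATy.subst, ih]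

theorem dropArgs_subst (ψ : SV → Option (SExp SV SF ar)) (n : ℕ) (T : ATy S (SExp SV SF ar)) :
    (T.dropArgs n).subst ψ = (T.subst ψ).dropArgs n := by
  induction T generalizing n with
  | base D => cases n <;> rfl
  | arrow U V _ ih =>
    cases n with
    | zero => rfl
    | succ n => exact ih n

theorem embed_eq_annotWith (T : Ty S) :
    (T.embed : ATy S E) = T.annotWith none fun i => (T.argTy i).embed := by
  induction T with
  | base D => rfl
  | arrow U V _ ih =>
    simp only [Ty.embed, Ty.annotWith, Ty.argTy]
    rw [ih]

theorem arrows_subst (ψ : SV → Option (SExp SV SF ar)) (Vs : List (ATy S (SExp SV SF ar)))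
    (V : ATy S (SExp SV SF ar)) :
    (ATy.arrows Vs V).subst ψ = ATy.arrows (Vs.map (ATy.subst ψ)) (V.subst ψ) := by
  induction Vs with
  | nil => rfl
  | cons U Vs ih => exact congrArg (ATy.arrow _) ih

end Annotated

/-! ### Semantics of annotated types and soundness of subtyping. -/

section AnnotatedInterp
variable {S C F : Type} {SV SF : Type*} [PartialOrder S] [WellFoundedLT S]
  {Sg : Sig S C F} {Al : SizeAlg S C F SV SF}
  (R : Set (Term S C F × Term S C F)) (CA : ConAnnot Sg Al)

/-- The interpretation of annotated types with respect to a valuation of the size variables. -/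
noncomputable def aInterp (ν : SV → Kh S C F) : ATy S Al.E → Set (Term S C F)
  | .base B none => sortInterp R CA.toAccArgs B
  | .base B (some a) => strat R CA B (a.eval Al.J ν)
  | .arrow U V => {t | ∀ u ∈ aInterp ν U, app t u ∈ aInterp ν V}

variable {R CA} {ν : SV → Kh S C F}

theorem isCP_aInterp (hR : FnRules R) : ∀ T : ATy S Al.E, IsCP R (aInterp R CA ν T)
  | .base B none => isCP_sortInterp B
  | .base B (some _) => isCP_strat B _
  | .arrow U V => isCP_arrow hR (isCP_aInterp hR U) (isCP_aInterp hR V)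

theorem aInterp_base_subset (B : S) (a : Option Al.E) :
    aInterp R CA ν (.base B a) ⊆ sortInterp R CA.toAccArgs B := by
  cases a with
  | none => exact subset_rfl
  | some a => exact strat_subset_sortInterp B _

theorem aInterp_embed (T : Ty S) :
    aInterp R CA ν T.embed = interp (sortInterp R CA.toAccArgs) T := by
  induction T with
  | base D => rfl
  | arrow U V ihU ihV => simp only [Ty.embed, aInterp, interp, ihU, ihV]

theorem aInterp_annot (B : S) (a : Al.E) (T : Ty S) :
    aInterp R CA ν (T.annot B (some a)) =
      interp (override (sortInterp R CA.toAccArgs) B (strat R CA B (a.eval Al.J ν))) T := by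
  induction T with
  | base D =>
    by_cases h : D = B
    · subst h
      simp only [Ty.annot, if_true, aInterp, interp, override_same]
    · simp only [Ty.annot, if_neg h, aInterp, interp, override_of_ne _ _ h]
  | arrow U V ihU ihV => simp only [Ty.annot, aInterp, interp, ihU, ihV]

theorem Sub.aInterp_subset {U V : ATy S Al.E} (h : Sub Al U V) :
    aInterp R CA ν U ⊆ aInterp R CA ν V := by
  induction h with
  | @size B a b h =>
    rcases h with rfl | ⟨a', b', rfl, rfl, h⟩
    · exact aInterp_base_subset B a
    · exact strat_mono B (Al.le_sound ν _ _ h)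
  | prod _ _ ihU ihV => exact fun t ht u hu => ihV (ht u (ihU hu))
  | refl => exact subset_rfl
  | trans _ _ ih ih' => exact ih.trans ih'

theorem apps_mem_of_arrows {Vs : List (ATy S Al.E)} {V : ATy S Al.E} {t : Term S C F}
    {ws : List (Term S C F)} (ht : t ∈ aInterp R CA ν (ATy.arrows Vs V))
    (hlen : ws.length = Vs.length)
    (h : ∀ (i : ℕ) (w : Term S C F) (W : ATy S Al.E), ws[i]? = some w → Vs[i]? = some W →
      w ∈ aInterp R CA ν W) : t.apps ws ∈ aInterp R CA ν V := by
  induction Vs generalizing t ws with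
  | nil => rwa [List.length_eq_zero_iff.1 hlen]
  | cons U Vs ih =>
    match ws, hlen with
    | w :: ws, hlen =>
      exact ih (t := app t w) (ht w (h 0 w U rfl rfl)) (Nat.succ_injective hlen)
        fun i w' W hw hW => h (i + 1) w' W hw hW

theorem mem_annotWith {σ : Option Al.E} {args : ℕ → ATy S Al.E} {T : Ty S} {t : Term S C F}
    (h : ∀ ts : List (Term S C F), ts.length = T.arity →
      (∀ i < T.arity, nth ts i ∈ aInterp R CA ν (args i)) →
      t.apps ts ∈ aInterp R CA ν (.base T.resSort σ)) :
    t ∈ aInterp R CA ν (T.annotWith σ args) := by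
  induction T generalizing args t with
  | base B => exact h [] rfl fun i hi => absurd hi (Nat.not_lt_zero i)
  | arrow U V _ ih =>
    refine fun u hu => ih fun ts hlen hts => h (u :: ts) (congrArg Nat.succ hlen) fun i hi => ?_
    cases i with
    | zero => exact hu
    | succ i => exact hts i (Nat.lt_of_succ_lt_succ hi)

theorem apps_mem_of_dropArgs {σ : Option Al.E} {args : ℕ → ATy S Al.E} {T : Ty S} {n : ℕ}
    {t : Term S C F} (ht : t ∈ aInterp R CA ν ((T.annotWith σ args).dropArgs n))
    {ts : List (Term S C F)} (hlen : n + ts.length = T.arity)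
    (h : ∀ i < ts.length, nth ts i ∈ aInterp R CA ν (args (n + i))) :
    t.apps ts ∈ aInterp R CA ν (.base T.resSort σ) := by
  induction T generalizing n args t ts with
  | base B =>
    obtain ⟨rfl, h0⟩ : n = 0 ∧ ts.length = 0 := by simpa [Ty.arity] using hlen
    rwa [List.length_eq_zero_iff.1 h0]
  | arrow U V _ ih =>
    simp only [Ty.arity] at hlen
    cases n with
    | succ n =>
      refine ih (n := n) ht (by omega) fun i hi => ?_
      have := h i hi
      rwa [show n + 1 + i = n + i + 1 by omega] at this
    | zero =>
      match ts, hlen, h with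
      | [], hlen, _ => simp at hlen
      | u :: ts, hlen, h =>
        refine ih (n := 0) (t := app t u) (ht u (h 0 (Nat.succ_pos _)))
          (by simp only [List.length_cons] at hlen; omega) fun i hi => ?_
        have := h (i + 1) (Nat.succ_lt_succ hi)
        rwa [show 0 + (i + 1) = 0 + i + 1 by omega] at this

theorem apps_mem_of_annotWith {σ : Option Al.E} {args : ℕ → ATy S Al.E} {T : Ty S}
    {t : Term S C F} (ht : t ∈ aInterp R CA ν (T.annotWith σ args))
    {ts : List (Term S C F)} (hlen : ts.length = T.arity)
    (h : ∀ i < T.arity, nth ts i ∈ aInterp R CA ν (args i)) :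
    t.apps ts ∈ aInterp R CA ν (.base T.resSort σ) :=
  apps_mem_of_dropArgs (n := 0) (args := args) (by cases T <;> exact ht)
    ((Nat.zero_add _).trans hlen) fun i hi => by
      rw [Nat.zero_add]
      exact h i (hlen ▸ hi)

/-! ## Computability of constructors -/

theorem con_mem_sortInterp (hR : FnRules R) {c : C} {ts : List (Term S C F)}
    (hlen : ts.length = (Sg.tyC c).arity)
    (hts : ∀ k < (Sg.tyC c).arity,
      nth ts k ∈ interp (sortInterp R CA.toAccArgs) ((Sg.tyC c).argTy k)) :
    apps (con c) ts ∈ sortInterp R CA.toAccArgs (Sg.tyC c).resSort := by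
  refine mem_sortInterp.2 ⟨sn_apps_con hR c fun k hk =>
    (isCP_interp hR isCP_sortInterp _).1 _ (hts k (hlen ▸ hk)), fun c' ts' hc k hk => ?_⟩
  obtain ⟨us, e, -, hus⟩ := steps_apps_con hR hc.2.2
  obtain ⟨rfl, rfl⟩ := apps_con_injective e
  exact (isCP_interp hR isCP_sortInterp _).steps (hts k (hk.trans_le (CA.q_le _))) (hus k)

/-- Each stage is closed under reduction, so reducing an argument cannot increase its size. -/
theorem conSize_le_of_steps (hR : FnRules R) {c : C} {ts us : List (Term S C F)} {k : ℕ}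
    (hts : nth ts k ∈ interp (sortInterp R CA.toAccArgs) ((Sg.tyC c).argTy k))
    (h : Steps R (nth ts k) (nth us k)) : conSize R CA c us k ≤ conSize R CA c ts k :=
  osize_le ((isCP_interp hR (fun B => by
    by_cases e : B = CA.srt c k
    · subst e; rw [override_same]; exact isCP_strat _ _
    · rw [override_of_ne _ _ e]; exact isCP_sortInterp B) _).steps (mem_interp_sizeIn hts) h)

/-- The stage is not a limit, so `mem_strat` applies. Constructor-headed terms reduce only inside
their arguments, whose sizes do not increase; positivity of the annotation then bounds the size
function on the reducts. -/
theorem con_mem_strat (hR : FnRules R)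
    (hlim : ∀ (c : C) (κ : ℕ → Kh S C F), ¬ Order.IsSuccLimit (CA.sizeFun c κ).1)
    {c : C} {ts : List (Term S C F)} {a : Al.E} (hσ : CA.σ c = some a)
    (hlen : ts.length = (Sg.tyC c).arity)
    (hts : ∀ k < (Sg.tyC c).arity,
      nth ts k ∈ interp (sortInterp R CA.toAccArgs) ((Sg.tyC c).argTy k)) :
    apps (con c) ts ∈ strat R CA (Sg.tyC c).resSort (CA.sizeFun c (conSize R CA c ts)) := by
  have hI : ∀ T, IsCP R (interp (sortInterp R CA.toAccArgs) T) := isCP_interp hR isCP_sortInterp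
  refine (mem_strat (hlim c _)).2 ⟨sn_apps_con hR c fun k hk => (hI _).1 _ (hts k (hlen ▸ hk)),
    fun c' ts' hc => ?_⟩
  obtain ⟨us, e, -, hus⟩ := steps_apps_con hR hc.2.2
  obtain ⟨rfl, rfl⟩ := apps_con_injective e
  refine ⟨fun k hk => ?_, fun k hp hk => (hI _).steps (hts k (hk.trans_le (CA.q_le _))) (hus k),
    ?_⟩
  · have hq := hk.trans_le (CA.p_le _)
    obtain ⟨v, hv⟩ := Option.ne_none_iff_exists'.1 (CA.α_rec _ k hk)
    -- Strict extensivity. A non-limit stage above some ordinal is a successor, so the recursive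
    -- argument fits in its predecessor.
    have hlt : conSize R CA c' ts k < CA.sizeFun c' (conSize R CA c' ts) := by
      refine lt_of_le_of_lt ?_ (lt_of_lt_of_eq (Al.lt_sound
        (CA.valuation c' (conSize R CA c' ts)) _ _ (CA.σ_ext _ k v a hk hv hσ)) ?_)
      · exact Finset.le_sup (f := conSize R CA c' ts)
          (Finset.mem_filter.2 ⟨Finset.mem_range.2 hq, hv⟩)
      · simp only [ConAnnot.sizeFun, hσ]
    obtain ⟨β, hβ⟩ := exists_eq_succ (hlim c' _) hlt
    refine ⟨β, hβ, ?_⟩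
    have hsize : nth ts k ∈ interp (override (sortInterp R CA.toAccArgs) (CA.srt c' k)
        (strat R CA (CA.srt c' k) (conSize R CA c' ts k))) ((Sg.tyC c').argTy k) :=
      mem_interp_sizeIn (hts k (hq.trans_le (CA.q_le _)))
    rw [CA.srt_rec _ k hk] at hsize
    have hm := interp_override_mono (sortInterp R CA.toAccArgs)
      (strat_mono (R := R) (CA := CA) (Sg.tyC c').resSort (le_of_lt_succ hlt hβ))
      (CA.onlyPos_argTy rfl hq) hsize
    exact (isCP_interp hR (fun B => by
      by_cases e : B = (Sg.tyC c').resSort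
      · subst e; rw [override_same]; exact isCP_strat _ _
      · rw [override_of_ne _ _ e]; exact isCP_sortInterp B) _).steps hm (hus k)
  · simp only [ConAnnot.sizeFun, hσ]
    refine Al.eval_mono (fun v _ => Finset.sup_mono_fun fun k hk => ?_)
      fun v _ => hσ ▸ CA.σ_mon _ v
    simp only [Finset.mem_filter, Finset.mem_range] at hk
    exact conSize_le_of_steps hR (hts k (hk.1.trans_le (CA.q_le _))) (hus k)

/-- Constructors are computable. -/
theorem con_mem_aInterp (hR : FnRules R)
    (hlim : ∀ (c : C) (κ : ℕ → Kh S C F), ¬ Order.IsSuccLimit (CA.sizeFun c κ).1)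
    (ψ : SV → Option Al.E) (c : C) : con c ∈ aInterp R CA ν ((CA.aty c).subst ψ) := by
  rw [ConAnnot.aty, annotWith_subst]
  refine mem_annotWith fun ts hlen hts => ?_
  have hann : ∀ k < CA.q c, (CA.argATy c k).subst ψ =
      ((Sg.tyC c).argTy k).annot (CA.srt c k) ((CA.α c k).bind ψ) := by
    intro k hk
    rw [ConAnnot.argATy, if_pos hk, annot_subst]
    cases CA.α c k <;> rfl
  have hI : ∀ k < (Sg.tyC c).arity,
      nth ts k ∈ interp (sortInterp R CA.toAccArgs) ((Sg.tyC c).argTy k) := by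
    intro k hk
    have h := hts k hk
    by_cases hq : k < CA.q c
    · rw [hann k hq] at h
      cases hα : (CA.α c k).bind ψ with
      | none => rwa [hα, annot_none, aInterp_embed] at h
      | some a =>
        rw [hα, aInterp_annot] at h
        refine interp_override_strat_subset _ _ (CA.onlyPos_srt hq fun e => ?_) h
        simp [e] at hα
    · rwa [ConAnnot.argATy, if_neg hq, embed_subst, aInterp_embed] at h
  cases hσ : CA.σ c with
  | none => exact con_mem_sortInterp hR hlen hI
  | some e =>
    cases he : e.substTop ψ with
    | none =>
      simp only [Option.bind_some, he]
      exact con_mem_sortInterp hR hlen hI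
    | some e' =>
      simp only [Option.bind_some, he]
      refine strat_mono _ ?_ (con_mem_strat hR hlim hσ hlen hI)
      -- With the true valuation as default, only variables with a finite instance need comparing,
      -- and there the annotated type of each argument bounds its size.
      rw [SExp.eval_of_substTop_eq_some Al.J ν (CA.valuation c (conSize R CA c ts)) ψ he]
      simp only [ConAnnot.sizeFun, hσ]
      refine Al.eval_mono (fun v _ => ?_) fun v _ => hσ ▸ CA.σ_mon _ v
      cases hv : ψ v with
      | none => exact le_rfl
      | some a =>
        refine Finset.sup_le fun k hk => ?_
        simp only [Finset.mem_filter, Finset.mem_range] at hk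
        have h := hts k (hk.1.trans_le (CA.q_le _))
        rw [hann k hk.1, hk.2, Option.bind_some, hv, aInterp_annot] at h
        exact osize_le h

end AnnotatedInterp
-- Rules take at most as many arguments as the declared type allows.
section Rules
variable {S C F : Type} {Sg : Sig S C F} {R : Set (Term S C F × Term S C F)}

theorem fnRules_of_isRule
    (hR : ∀ l r, (l, r) ∈ R → IsRule Sg l r) : FnRules R := fun l r h => (hR l r h).1

theorem HasType.arity_apps_fn {Γ : ℕ → Option (Ty S)} {f : F} {ls : List (Term S C F)} {T : Ty S}
    (h : HasType Sg Γ (apps (.fn f) ls) T) : T.arity + ls.length = (Sg.tyF f).arity := by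
  induction ls using List.reverseRecOn generalizing T with
  | nil => cases h; rfl
  | append_singleton ls l ih =>
    rw [apps_concat] at h
    cases h with
    | app ht _ =>
      rw [← ih ht]
      simp [Ty.arity]
      omega

theorem length_le_arity
    (hR : ∀ l r, (l, r) ∈ R → IsRule Sg l r) {f : F} {ls : List (Term S C F)} {r : Term S C F}
    (h : (apps (fn f) ls, r) ∈ R) : ls.length ≤ (Sg.tyF f).arity := by
  obtain ⟨-, -, ⟨Δ, T, -, hT⟩, -⟩ := hR _ r h
  exact hT.arity_apps_fn ▸ Nat.le_add_left _ _

end Rules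

/-! ### Annotated arguments and the order on function calls. -/

section FunAnnot
variable {S C F : Type} {SV SF DA DK : Type*} [Preorder F] {Sg : Sig S C F}
  {Al : SizeAlg S C F SV SF} {FA : FunAnnot Sg Al DA DK}

theorem FunAnnot.argATy_of_lt {f : F} {i : ℕ} (h : i < FA.q f) :
    ∃ B, (Sg.tyF f).argTy i = .base B ∧ FA.argATy f i = .base B (some (.var (FA.α f ⟨i, h⟩))) := by
  obtain ⟨B, hB⟩ := FA.arg_sort f i h
  refine ⟨B, hB, ?_⟩
  rw [FunAnnot.argATy, dif_pos h, hB]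
  simp [Ty.annot, Ty.resSort]

theorem FunAnnot.argATy_of_le {f : F} {i : ℕ} (h : FA.q f ≤ i) :
    FA.argATy f i = ((Sg.tyF f).argTy i).embed := by
  rw [FunAnnot.argATy, dif_neg (not_lt.2 h)]

theorem FunAnnot.ltK_of_le {g f : F} (hgf : g ≤ f) (hfg : f ≤ g) {x : Fin (FA.q g) → Kh S C F}
    {y z : Fin (FA.q f) → Kh S C F} (h : FA.ltK f (FA.ζK g x) (FA.ζK f y)) (hyz : ∀ i, y i ≤ z i) :
    FA.ltK f (FA.ζK g x) (FA.ζK f z) := by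
  have key : ∀ s : Finset (Fin (FA.q f)), FA.ltK f (FA.ζK g x) (FA.ζK f (s.piecewise z y)) := by
    intro s
    induction s using Finset.induction with
    | empty => simpa using h
    | insert j s hj ih =>
      refine FA.compatK g f x _ _ hgf hfg ih ⟨j, ?_, fun i hi => ?_⟩
      · rw [s.piecewise_eq_of_notMem _ _ hj, Finset.piecewise_eq_of_mem _ _ _ (s.mem_insert_self j)]
        exact hyz j
      · rw [Finset.piecewise_insert, Function.update_of_ne hi]
  simpa using key Finset.univ

end FunAnnot

section Functions
variable {S C F : Type} {SV SF DA DK : Type*} [PartialOrder S] [WellFoundedLT S] [Preorder F]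
  {Sg : Sig S C F} {Al : SizeAlg S C F SV SF}
  {R : Set (Term S C F × Term S C F)} {CA : ConAnnot Sg Al} {FA : FunAnnot Sg Al DA DK}
  {ν : SV → Kh S C F}

/-! ## Correctness of the computability closure -/

/-- Induction on the closure derivation. The hypothesis `hcall` isolates the computability of the
symbols that may be called, to be supplied by the well-founded induction on calls. -/
theorem Clos.mem_aInterp (hR : FnRules R)
    (hlim : ∀ (c : C) (κ : ℕ → Kh S C F), ¬ Order.IsSuccLimit (CA.sizeFun c κ).1)
    {f : F} {φ : SV → Al.E}
    (hcall : ∀ (h : F) (ψ : SV → Option Al.E),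
      (h < f ∨ ∃ a : Fin (FA.q h) → Al.E, (∀ i, ψ (FA.α h i) = some (a i)) ∧
        FA.CallLt h f a fun i => φ (FA.α f i)) →
      fn h ∈ aInterp R CA ν ((FA.aty h).subst ψ))
    {Γ : ℕ → Option (ATy S Al.E)} {t : Term S C F} {T : ATy S Al.E}
    (h : Clos CA FA f φ Γ t T) {θ : ℕ → Term S C F}
    (hθ : ∀ x U, Γ x = some U → θ x ∈ aInterp R CA ν U) :
    t.subst θ ∈ aInterp R CA ν T := by
  have getElem_map : ∀ {ψ : SV → Option Al.E} {θ : ℕ → Term S C F} {ws : List (Term S C F)}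
      {Vs : List (ATy S Al.E)}, (∀ (i : ℕ) (w : Term S C F) (W : ATy S Al.E), ws[i]? = some w →
        Vs[i]? = some W → w.subst θ ∈ aInterp R CA ν (W.subst ψ)) →
      ∀ (i : ℕ) (w : Term S C F) (W : ATy S Al.E), (ws.map (Term.subst θ))[i]? = some w →
        (Vs.map (ATy.subst ψ))[i]? = some W → w ∈ aInterp R CA ν W := by
    intro ψ θ ws Vs hws i w W hw hW
    simp only [List.getElem?_map, Option.map_eq_some_iff] at hw hW
    obtain ⟨w, hw, rfl⟩ := hw
    obtain ⟨W, hW, rfl⟩ := hW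
    exact hws i w W hw hW
  induction h generalizing θ with
  | @appVar Γ x Vs V ws hx hlen _ ih =>
    rw [subst_apps]
    refine apps_mem_of_arrows (hθ x _ hx) (by simpa using hlen) fun i w W hw hW => ?_
    simp only [List.getElem?_map, Option.map_eq_some_iff] at hw
    obtain ⟨w, hw, rfl⟩ := hw
    exact ih i w W hw hW hθ
  | @appCon Γ c Vs V ws ψ hc hlen _ ih =>
    rw [subst_apps]
    refine apps_mem_of_arrows (Vs := Vs.map (ATy.subst ψ)) ?_ (by simpa using hlen)
      (getElem_map fun i w W hw hW => ih i w W hw hW hθ)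
    rw [← arrows_subst, ← hc]
    exact con_mem_aInterp hR hlim ψ c
  | @appFn Γ h Vs V ws ψ hh hlen _ hlt _ ih =>
    rw [subst_apps]
    refine apps_mem_of_arrows (Vs := Vs.map (ATy.subst ψ)) ?_ (by simpa using hlen)
      (getElem_map fun i w W hw hW => ih i w W hw hW hθ)
    rw [← arrows_subst, ← hh]
    exact hcall h ψ hlt
  | @lam Γ U V w _ ih =>
    refine app_lam_mem hR (isCP_aInterp hR _) (isCP_aInterp hR _) U fun u hu => ?_
    rw [subst_up_inst]
    refine ih fun x W hx => ?_
    cases x with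
    | zero => cases hx; exact hu
    | succ x => exact hθ x W hx
  | sub _ hs ih => exact hs.aInterp_subset (ih hθ)

/-! ## Computability of function symbols -/

/-- A function symbol has all the instances of its annotated type when it is computable for all
valuations. -/
theorem fn_mem_aInterp_subst {h : F} {ψ : SV → Option Al.E}
    (hh : ∀ μ : SV → Kh S C F, (∀ v a, ψ v = some a → μ v = a.eval Al.J ν) →
      fn h ∈ aInterp R CA μ (FA.aty h)) :
    fn h ∈ aInterp R CA ν ((FA.aty h).subst ψ) := by
  rw [FunAnnot.aty, annotWith_subst]
  refine mem_annotWith fun ts hlen hts => ?_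
  -- A variable sent to `∞` gives no bound, so it is valued by the actual size of the one argument
  -- that it annotates; injectivity of `α` makes this consistent.
  let d : SV → Kh S C F := Function.extend (FA.α h)
    (fun i => osize (strat R CA ((Sg.tyF h).argTy i).resSort) (nth ts i)) fun _ => ⊥
  have h1 := apps_mem_of_annotWith
    (hh (fun v => (ψ v).elim (d v) (SExp.eval Al.J ν)) fun v a hv => by simp [hv]) hlen
    fun i hi => ?_
  · cases hσ : FA.σ h with
    | none => rwa [hσ] at h1
    | some e =>
      rw [hσ] at h1
      cases he : e.substTop ψ with
      | none =>
        simp only [Option.bind_some, he]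
        exact aInterp_base_subset _ _ h1
      | some e' =>
        simp only [Option.bind_some, he, aInterp]
        rwa [SExp.eval_of_substTop_eq_some Al.J ν d ψ he]
  · have hi' := hts i hi
    by_cases hq : i < FA.q h
    · obtain ⟨B, hB, hA⟩ := FA.argATy_of_lt hq
      rw [hA] at hi' ⊢
      simp only [ATy.subst, Option.bind_some, SExp.substTop] at hi'
      simp only [aInterp, SExp.eval]
      cases hψ : ψ (FA.α h ⟨i, hq⟩) with
      | none =>
        rw [hψ] at hi'
        simp only [Option.elim_none, d, (FA.α_inj h).extend_apply, hB, Ty.resSort]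
        exact mem_strat_osize hi'
      | some a => rwa [hψ] at hi'
    · rw [FA.argATy_of_le (not_lt.1 hq)] at hi' ⊢
      rw [embed_subst, aInterp_embed] at hi'
      rwa [aInterp_embed]

variable (hR : ∀ l r, (l, r) ∈ R → IsRule Sg l r)
  (hlim : ∀ (c : C) (κ : ℕ → Kh S C F), ¬ Order.IsSuccLimit (CA.sizeFun c κ).1)
  (hcrit : ∀ l r, (l, r) ∈ R → RuleCriterion R CA FA l r)

include hR hlim in
/-- Head reducts of computable function calls are computable. -/
theorem rule_mem_aInterp {f : F} {μ : SV → Kh S C F}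
    (ih : ∀ (h : F) (μ' : SV → Kh S C F), (h < f ∨ ((h ≤ f ∧ f ≤ h) ∧
      FA.ltK f (FA.ζK h fun i => μ' (FA.α h i)) (FA.ζK f fun i => μ (FA.α f i)))) →
      fn h ∈ aInterp R CA μ' (FA.aty h))
    {ls us : List (Term S C F)} {r : Term S C F} (θ : ℕ → Term S C F)
    (hlen : (ls.map (Term.subst θ) ++ us).length = (Sg.tyF f).arity)
    (hts : ∀ i < (Sg.tyF f).arity,
      nth (ls.map (Term.subst θ) ++ us) i ∈ aInterp R CA μ (FA.argATy f i))
    (hcrit : RuleCriterion R CA FA (apps (fn f) ls) r) :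
    apps (r.subst θ) us ∈ aInterp R CA μ (.base (Sg.tyF f).resSort (FA.σ f)) := by
  have hR' := fnRules_of_isRule hR
  obtain ⟨g, ls', e, hq, Γ, k, Bx, αx, φ, hΓ, hmon, hacc, hmin, hdec⟩ := hcrit
  obtain ⟨rfl, rfl⟩ := apps_fn_injective e
  have hl : ls.length ≤ (Sg.tyF f).arity := by rw [← hlen]; simp
  have hnth : ∀ i < ls.length,
      nth (ls.map (Term.subst θ) ++ us) i = (nth ls i).subst θ := fun i hi => by
    rw [nth_lt hi, nth_lt (by simp; omega)]
    simp [hi]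
  have hcomp : ∀ i < ls.length, (nth ls i).subst θ ∈
      interp (sortInterp R CA.toAccArgs) ((Sg.tyF f).argTy i) := by
    intro i hi
    have h := hts i (hi.trans_le hl)
    rw [hnth i hi] at h
    by_cases hq : i < FA.q f
    · obtain ⟨B, hB, hA⟩ := FA.argATy_of_lt hq
      rw [hA] at h
      rw [hB]
      exact aInterp_base_subset _ _ h
    · rwa [FA.argATy_of_le (not_lt.1 hq), aInterp_embed] at h
  obtain ⟨ν, hν, hsize⟩ := hmin θ hcomp
  -- The left side is the exact size of the argument by minimality, while `μ` only bounds it.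
  have hle : ∀ i, (φ (FA.α f i)).eval Al.J ν ≤ μ (FA.α f i) := by
    intro i
    have hi := i.2.trans_le hq
    have h := hts i (hi.trans_le hl)
    obtain ⟨B, hB, hA⟩ := FA.argATy_of_lt i.2
    rw [hA, hnth i hi] at h
    rw [hsize i, hB]
    exact osize_le h
  have henv : ∀ x U, Γ x = some U → θ x ∈ aInterp R CA ν U := by
    intro x U hx
    obtain ⟨hk, -, hpos, hU⟩ := hΓ.2 x U hx
    have hθ : θ x ∈ interp (sortInterp R CA.toAccArgs) U.erase := by
      have hkx := hcomp (k x) hk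
      rcases hacc x U hx with ⟨hv, hU'⟩ | ⟨B, hB, ha⟩
      · have he : U.erase = (Sg.tyF f).argTy (k x) := by
          rw [hU']
          by_cases hq : k x < FA.q f
          · rw [FunAnnot.argATy, dif_pos hq, annot_subst, erase_annot]
          · rw [FunAnnot.argATy, dif_neg hq, embed_subst, erase_embed]
        rw [← hv] at hkx
        rwa [he]
      · exact ha.mem_interp θ (hB ▸ hkx)
    rw [hU, aInterp_annot]
    exact interp_override_mono _ (strat_mono _ (hν x U hx)) hpos (mem_interp_sizeIn hθ)
  have hr := hdec.mem_aInterp (ν := ν) hR' hlim (fun h ψ hcall =>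
    fn_mem_aInterp_subst fun μ' hμ' => ih h μ' <| hcall.imp_right ?_) henv
  · rw [dropArgs_subst, FunAnnot.aty, annotWith_subst] at hr
    have h1 := apps_mem_of_dropArgs hr (ts := us) (by simpa using hlen) fun i hi => ?_
    · cases hσ : FA.σ f with
      | none => rwa [hσ] at h1
      | some e =>
        rw [hσ] at h1
        obtain ⟨e', he⟩ := Option.isSome_iff_exists.1 (SExp.isSome_substTop φ e)
        simp only [Option.bind_some, he, aInterp] at h1 ⊢
        -- The closure bounds the result at the exact sizes; positivity of the annotation of `f`
        -- passes to the larger values `μ`.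
        refine strat_mono _ ?_ h1
        rw [SExp.eval_of_substTop_eq_some Al.J ν ν _ he]
        refine Al.eval_mono (fun v hv => ?_) fun v hv => ?_ <;>
          obtain ⟨i, rfl⟩ := FA.σ_vars f e hσ hv
        · exact hle i
        · exact hσ ▸ hmon i
    · have hi' : ls.length + i < (ls.map (Term.subst θ) ++ us).length := by simpa using hi
      have h := hts (ls.length + i) (hlen ▸ hi')
      rw [FA.argATy_of_le (hq.trans (Nat.le_add_right _ _)), aInterp_embed, nth_lt hi'] at h
      rw [FA.argATy_of_le (hq.trans (Nat.le_add_right _ _)), embed_subst, aInterp_embed, nth_lt hi]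
      simpa [List.getElem_append] using h
  · rintro ⟨a, ha, heq, hlt⟩
    refine ⟨heq, ?_⟩
    have hlt' := FA.ltK_of_le heq.1 heq.2 (FA.sound h f a _ heq.1 heq.2 hlt ν) hle
    rwa [show (fun i => (a i).eval Al.J ν) = fun i => μ' (FA.α h i) from
      funext fun i => (hμ' _ _ (ha i)).symm] at hlt'

include hR hlim hcrit in
-- No rule takes more arguments than the arity, so the maximally applied symbol is neutral. Its
-- reducts come either from a step in an argument, covered by accessibility of `ListStep`, or from a
-- rule at the head.
theorem fn_mem_aInterp_of_smaller {f : F} {μ : SV → Kh S C F}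
    (ih : ∀ (h : F) (μ' : SV → Kh S C F), (h < f ∨ ((h ≤ f ∧ f ≤ h) ∧
      FA.ltK f (FA.ζK h fun i => μ' (FA.α h i)) (FA.ζK f fun i => μ (FA.α f i)))) →
      fn h ∈ aInterp R CA μ' (FA.aty h)) :
    fn f ∈ aInterp R CA μ (FA.aty f) := by
  have hR' := fnRules_of_isRule hR
  refine mem_annotWith fun ts hlen hts => ?_
  have hacc := acc_listStep (R := R) ts fun k hk =>
    (isCP_aInterp hR' _).1 _ (hts k (hlen ▸ hk))
  induction hacc with
  | intro ts _ ihts =>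
    refine (isCP_aInterp hR' _).2.2 _ (.inr (.inr ⟨f, ts, rfl, fun ls r h => hlen ▸
      length_le_arity hR h⟩)) fun u hu => ?_
    rcases step_apps_fn hR' hu with ⟨ts', hs, rfl⟩ | ⟨ls, r, θ, us, hr, rfl, rfl⟩
    · refine ihts ts' hs (hs.length_eq.trans hlen) fun i hi => ?_
      rcases hs.nth i with e | e
      · exact e ▸ hts i hi
      · exact (isCP_aInterp hR' _).2.1 _ (hts i hi) _ e
    · exact rule_mem_aInterp hR hlim ih θ hlen hts (hcrit _ r hr)

include hR hlim hcrit in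
/-- Function symbols are computable. -/
theorem fn_mem_aInterp [WellFoundedLT F] (f : F) (μ : SV → Kh S C F) :
    fn f ∈ aInterp R CA μ (FA.aty f) := by
  induction f using WellFoundedLT.induction generalizing μ with
  | ind f ihf =>
    -- The inner induction runs over a common domain `DK` for all symbols equivalent to `f` at once,
    -- since a call may pass from one to another.
    have key : ∀ (d : DK) (h : F) (μ : SV → Kh S C F), h ≤ f → f ≤ h →
        (FA.ζK h fun i => μ (FA.α h i)) = d → fn h ∈ aInterp R CA μ (FA.aty h) := by
      intro d
      induction d using (FA.ltK_wf f).induction with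
      | h d ihd =>
        rintro h μ hhf hfh rfl
        refine fn_mem_aInterp_of_smaller hR hlim hcrit fun g μ' hg => ?_
        rcases hg with hg | ⟨⟨hgh, hhg⟩, hlt⟩
        · exact ihf g (hg.trans_le hhf) μ'
        · rw [(FA.eqv h f hhf hfh).2.2.2] at hlt
          exact ihd _ hlt g μ' (hgh.trans hhf) (hfh.trans hhg) rfl
    exact key _ f μ le_rfl le_rfl rfl

include hR hlim hcrit in
/-- Well-typed terms are computable. -/
theorem HasType.mem_interp [WellFoundedLT F] {Γ : ℕ → Option (Ty S)} {t : Term S C F} {T : Ty S}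
    (h : HasType Sg Γ t T) {θ : ℕ → Term S C F}
    (hθ : ∀ x U, Γ x = some U → θ x ∈ interp (sortInterp R CA.toAccArgs) U) :
    t.subst θ ∈ interp (sortInterp R CA.toAccArgs) T := by
  have hR' := fnRules_of_isRule hR
  induction h generalizing θ with
  | var hx => exact hθ _ _ hx
  | @con Γ c =>
    rw [← aInterp_embed (ν := fun _ => (⊥ : Kh S C F)), embed_eq_annotWith]
    refine mem_annotWith fun ts hlen hts => con_mem_sortInterp hR' hlen fun k hk => ?_
    exact aInterp_embed (R := R) (CA := CA) _ ▸ hts k hk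
  | @fn Γ f =>
    rw [← aInterp_embed (ν := fun _ => (⊥ : Kh S C F)), embed_eq_annotWith]
    refine mem_annotWith fun ts hlen hts => ?_
    -- Sending all size variables to `∞` erases the argument annotations. A closed result annotation
    -- survives, hence the inclusion of stages in the sort below.
    have h := fn_mem_aInterp_subst (ν := fun _ => (⊥ : Kh S C F)) (ψ := fun _ => none)
      fun μ _ => fn_mem_aInterp hR hlim hcrit f μ
    rw [FunAnnot.aty, annotWith_subst] at h
    refine aInterp_base_subset _ _ (apps_mem_of_annotWith h hlen fun i hi => ?_)
    have hi' := hts i hi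
    by_cases hq : i < FA.q f
    · obtain ⟨B, hB, hA⟩ := FA.argATy_of_lt hq
      rw [hA]
      rwa [hB] at hi'
    · rwa [FA.argATy_of_le (not_lt.1 hq), embed_subst]
  | @lam Γ U V t _ ih =>
    refine app_lam_mem hR' (isCP_interp hR' isCP_sortInterp _)
      (isCP_interp hR' isCP_sortInterp _) U fun u hu => ?_
    rw [subst_up_inst]
    refine ih fun x W hx => ?_
    cases x with
    | zero => cases hx; exact hu
    | succ x => exact hθ x W hx
  | app _ _ iht ihu => exact iht hθ _ (ihu hθ)

end Functions

end SizeTermination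

/-! ### Strong normalization of well-typed terms. -/

open SizeTermination
theorem mainTheorem1 {S C F : Type} {SV SF DA DK : Type*}
    [PartialOrder S] [WellFoundedLT S] [Preorder F] [WellFoundedLT F]
    (Sg : Sig S C F) (R : Set (Term S C F × Term S C F))
    (hR : ∀ l r, (l, r) ∈ R → IsRule Sg l r)
    (Al : SizeAlg S C F SV SF) (CA : ConAnnot Sg Al) (FA : FunAnnot Sg Al DA DK)
    (hfin : FinitelyBranching (RwStep R))
    (hlim : ∀ (c : C) (κ : ℕ → Kh S C F), ¬ Order.IsSuccLimit (CA.sizeFun c κ).1)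
    (hcrit : ∀ l r, (l, r) ∈ R → RuleCriterion R CA FA l r) :
    ∀ t : Term S C F, WellTyped Sg t → SN R t := by
  rintro t ⟨Γ, T, -, ht⟩
  have hCP := isCP_interp (fnRules_of_isRule hR) (isCP_sortInterp (R := R) (AA := CA.toAccArgs))
  -- The identity substitution is computable because variables belong to every computability
  -- predicate.
  have h := ht.mem_interp hR hlim hcrit (θ := Term.var)
    fun x U _ => (hCP U).var_mem (fnRules_of_isRule hR) x
  rw [Term.subst_var] at h
  exact (hCP T).1 t h
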